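/- **Model.** Fix $I\ge 1$ testing conditions with inspection times $\tau_i>0$ and stress vectors $\boldsymbol x_i=(x_{i0},\dots,x_{iJ})\in\mathbb R^{J+1}$. For $\boldsymbol\theta=(a_0,\dots,a_J,b_0,\dots,b_J)\in\mathbb R^{2(J+1)}$ put $\alpha_i=\exp(\sum_j a_jx_{ij})$, $\beta_i=\exp(\sum_j b_jx_{ij})$, $$F_i(\boldsymbol\theta)=\frac{\tau_i^{\beta_i}}{\tau_i^{\beta_i}+\alpha_i^{\beta_i}},\qquad R_i(\boldsymbol\theta)=1-F_i(\boldsymbol\theta).$$ The lifetimes $T_{ik}$ ($i=1,\dots,I$, $k=1,2,\dots$) are independent, and under the true parameter $\boldsymbol\theta_0$ the variable $T_{ik}$ is log-logistic, $\Pr(T_{ik}\le t)=t^{\beta_i}/(t^{\beta_i}+\alpha_i^{\beta_i})$ for $t>0$, with $\alpha_i,\beta_i$ taken at $\boldsymbol\theta_0$. One observes only the numbers $n_i=\#\{k\le K_i: T_{ik}\le\tau_i\}$ of failures among $K_i$ devices. Put $K=K_1+\dots+K_I$ and $\hat p_{i1}=n_i/K_i$, $\hat p_{i2}=1-\hat p_{i1}$.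 The numbers $K_i$ vary with $K$, and as $K\to\infty$, $K_i/K\to w_i>0$ for each $i$. **Estimator.** Let $\gamma\ge 0$. For probability vectors $p=(p_1,p_2)$, $q=(q_1,q_2)$ let $$D_\gamma(p,q)=\sum_{j=1}^2 q_j^{\gamma+1}-\frac{\gamma+1}{\gamma}\sum_{j=1}^2 p_jq_j^\gamma+\frac1\gamma\sum_{j=1}^2 p_j^{\gamma+1}\quad(\gamma>0),\qquad D_0(p,q)=\sum_{j=1}^2p_j\log\frac{p_j}{q_j}.$$ Let $\Theta\subseteq\mathbb R^{2(J+1)}$ be the parameter space. The weighted minimum density power divergence estimator (WMDPDE) $\hat{\boldsymbol\theta}_\gamma$ is a function of the data which is a minimizer over $\boldsymbol\theta\in\Theta$ of $\sum_{i=1}^I\frac{K_i}{K}D_\gamma\big((\hat p_{i1},\hat p_{i2}),(F_i(\boldsymbol\theta),R_i(\boldsymbol\theta))\big)$ for all data for which a minimizer exists (and is an arbitrary point otherwise). **Statistic.** Let $$\boldsymbol J_\gamma(\boldsymbol\theta)=\sum_{i=1}^I\frac{K_i}{K}(R_iF_i)^2\big(F_i^{\gamma-1}+R_i^{\gamma-1}\big)\boldsymbol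 M_i,\qquad \boldsymbol K_\gamma(\boldsymbol\theta)=\sum_{i=1}^I\frac{K_i}{K}\big(F_i^{\gamma-1}+R_i^{\gamma-1}\big)^2F_i^3R_i^3\,\boldsymbol M_i,$$ $$\boldsymbol M_i=\begin{pmatrix}\beta_i^2\boldsymbol x_i\boldsymbol x_i^T&-\log\frac{\tau_i}{\alpha_i}\,\beta_i^2\boldsymbol x_i\boldsymbol x_i^T\\-\log\frac{\tau_i}{\alpha_i}\,\beta_i^2\boldsymbol x_i\boldsymbol x_i^T&\big(\log\frac{\tau_i}{\alpha_i}\,\beta_i\big)^2\boldsymbol x_i\boldsymbol x_i^T\end{pmatrix},$$ and $\boldsymbol\Sigma(\boldsymbol\theta)=\boldsymbol J_\gamma^{-1}(\boldsymbol\theta)\boldsymbol K_\gamma(\boldsymbol\theta)\boldsymbol J_\gamma^{-1}(\boldsymbol\theta)$. For $r\ge1$ and $\boldsymbol m:\mathbb R^{2(J+1)}\to\mathbb R^r$ let $\boldsymbol M(\boldsymbol\theta)=\partial\boldsymbol m^T(\boldsymbol\theta)/\partial\boldsymbol\theta$ (a $2(J+1)\times r$ matrix). The Wald-type statistic is $$W_K(\hat{\boldsymbol\theta}_\gamma)=K\,\boldsymbol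 m(\hat{\boldsymbol\theta}_\gamma)^T\Big(\boldsymbol M(\hat{\boldsymbol\theta}_\gamma)^T\boldsymbol\Sigma(\hat{\boldsymbol\theta}_\gamma)\boldsymbol M(\hat{\boldsymbol\theta}_\gamma)\Big)^{-1}\boldsymbol m(\hat{\boldsymbol\theta}_\gamma).$$ **Regularity at $\boldsymbol\theta_0$.** (i) $\boldsymbol\theta_0$ is an interior point of $\Theta$; (ii) $\boldsymbol\theta_0$ is identifiable: for every $\varepsilon>0$, $\inf\{\max_i|F_i(\boldsymbol\theta)-F_i(\boldsymbol\theta_0)|:\boldsymbol\theta\in\Theta,\ \|\boldsymbol\theta-\boldsymbol\theta_0\|\ge\varepsilon\}>0$ (for compact $\Theta$ this says that no other $\boldsymbol\theta\in\Theta$ has the same failure probabilities); (iii) $\boldsymbol J_\gamma(\boldsymbol\theta_0)$, taken with the limiting proportions $w_i$ in place of $K_i/K$, is nonsingular; (iv) $\boldsymbol m$ is differentiable in a neighbourhood of $\boldsymbol\theta_0$, $\boldsymbol M$ is continuous at $\boldsymbol\theta_0$, and $\operatorname{rank}\boldsymbol M(\boldsymbol\theta_0)=r$. **Claim.** Let $\chi^2_{r,\alpha}$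 denote the upper $\alpha$-quantile of the chi-square law $\chi^2_r$, $0<\alpha<1$. 1. If $\boldsymbol m(\boldsymbol\theta_0)=\boldsymbol 0$ (the null hypothesis $H_0$), then $W_K(\hat{\boldsymbol\theta}_\gamma)\to\chi^2_r$ in law as $K\to\infty$; and rejecting $H_0$ when $W_K(\hat{\boldsymbol\theta}_\gamma)>\chi^2_{r,\alpha}$ has asymptotic level $\alpha$: $\Pr\big(W_K(\hat{\boldsymbol\theta}_\gamma)>\chi^2_{r,\alpha}\big)\to\alpha$ for every $\alpha\in(0,1)$. 2. If $\boldsymbol m(\boldsymbol\theta_0)\ne\boldsymbol 0$ (a fixed alternative), then $\Pr\big(W_K(\hat{\boldsymbol\theta}_\gamma)>\chi^2_{r,\alpha}\big)\to1$ as $K\to\infty$ for every $\alpha\in(0,1)$. -/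

import Mathlib

open MeasureTheory ProbabilityTheory Filter Topology Matrix

namespace OneShot

noncomputable section

/-- Index set of the parameter `θ = (a_0, …, a_J, b_0, …, b_J)`: the left summand indexes the
`a_j`, the right summand the `b_j`. -/
abbrev Idx (J : ℕ) : Type := Fin (J + 1) ⊕ Fin (J + 1)

/-- Parameter vectors, that is, points of `ℝ^{2(J+1)}`. -/
abbrev Param (J : ℕ) : Type := Idx J → ℝ

/-! ### The log-logistic model -/

/-- Distribution function of the log-logistic law with scale `α` and shape `β`, for `t > 0`. -/
def logLogisticCDF (α β t : ℝ) : ℝ := t ^ β / (t ^ β + α ^ β)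

/-- Reliability function of the log-logistic law with scale `α` and shape `β`, for `t > 0`. -/
def logLogisticRel (α β t : ℝ) : ℝ := α ^ β / (t ^ β + α ^ β)

/-- The random variable `T` has the log-logistic law with scale `α` and shape `β` under `P`. -/
def IsLogLogistic {Ω : Type*} [MeasurableSpace Ω] (P : Measure Ω) (T : Ω → ℝ) (α β : ℝ) : Prop :=
  Measurable T ∧ ∀ t : ℝ, 0 < t → P.real {ω | T ω ≤ t} = logLogisticCDF α β t

section Model

variable {J : ℕ}

/-- Scale parameter under the stress vector `x`: `α = exp (∑ j, a_j x_j)`. -/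
def scale (x : Fin (J + 1) → ℝ) (θ : Param J) : ℝ := Real.exp (∑ j, θ (Sum.inl j) * x j)

/-- Shape parameter under the stress vector `x`: `β = exp (∑ j, b_j x_j)`. -/
def shape (x : Fin (J + 1) → ℝ) (θ : Param J) : ℝ := Real.exp (∑ j, θ (Sum.inr j) * x j)

/-- Probability of failure before the inspection time `τ` under the stress vector `x`. -/
def failProb (τ : ℝ) (x : Fin (J + 1) → ℝ) (θ : Param J) : ℝ :=
  logLogisticCDF (scale x θ) (shape x θ) τ

/-- Reliability at the inspection time `τ` under the stress vector `x`. -/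
def relProb (τ : ℝ) (x : Fin (J + 1) → ℝ) (θ : Param J) : ℝ :=
  logLogisticRel (scale x θ) (shape x θ) τ

end Model

/-! ### Divergences and the estimator -/

/-- Density power divergence with tuning parameter `γ` between the probability vectors
`(p₁, p₂)` and `(q₁, q₂)`; for `γ = 0` it is the Kullback-Leibler divergence. -/
def dpd (γ p₁ p₂ q₁ q₂ : ℝ) : ℝ :=
  if γ = 0 then p₁ * Real.log (p₁ / q₁) + p₂ * Real.log (p₂ / q₂)
  else (q₁ ^ (γ + 1) + q₂ ^ (γ + 1)) - (γ + 1) / γ * (p₁ * q₁ ^ γ + p₂ * q₂ ^ γ)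
    + 1 / γ * (p₁ ^ (γ + 1) + p₂ ^ (γ + 1))

section Experiment

variable {I J : ℕ}

/-- Total number of devices `K = K_1 + ⋯ + K_I`. -/
def total (K : Fin I → ℕ) : ℝ := ∑ i, (K i : ℝ)

/-- Proportion `K_i / K` of the devices that are placed under condition `i`. -/
def proportion (K : Fin I → ℕ) (i : Fin I) : ℝ := (K i : ℝ) / total K

/-- Weighted density power divergence between the empirical probability vectors, computed from the
numbers of failures `n` among `K` devices, and the theoretical ones at `θ`. -/
def weightedDPD (γ : ℝ) (τ : Fin I → ℝ) (x : Fin I → Fin (J + 1) → ℝ) (K n : Fin I → ℕ)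
    (θ : Param J) : ℝ :=
  ∑ i, proportion K i *
    dpd γ ((n i : ℝ) / K i) (1 - (n i : ℝ) / K i) (failProb (τ i) (x i) θ) (relProb (τ i) (x i) θ)

/-- `θ` minimizes the weighted density power divergence over the parameter space `Θ`. -/
def IsMinimizer (γ : ℝ) (τ : Fin I → ℝ) (x : Fin I → Fin (J + 1) → ℝ) (Θ : Set (Param J))
    (K n : Fin I → ℕ) (θ : Param J) : Prop :=
  θ ∈ Θ ∧ IsMinOn (weightedDPD γ τ x K n) Θ θ

/-- `est` is a weighted minimum density power divergence estimator: a function of the numbers of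
devices `K` and of failures `n` which, for all data for which a minimizer exists, is one. -/
def IsWMDPDE (γ : ℝ) (τ : Fin I → ℝ) (x : Fin I → Fin (J + 1) → ℝ) (Θ : Set (Param J))
    (est : (Fin I → ℕ) → (Fin I → ℕ) → Param J) : Prop :=
  ∀ K n : Fin I → ℕ, (∀ i, n i ≤ K i) → (∃ θ, IsMinimizer γ τ x Θ K n θ) →
    IsMinimizer γ τ x Θ K n (est K n)

/-- Numbers of failures up to the inspection times, when condition `i` is applied to `K i` devices
with lifetimes `T i 0, T i 1, …`. -/
def failures {Ω : Type*} (τ : Fin I → ℝ) (T : Fin I → ℕ → Ω → ℝ) (K : Fin I → ℕ) (ω : Ω)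
    (i : Fin I) : ℕ :=
  ((Finset.range (K i)).filter fun k => T i k ω ≤ τ i).card

/-! ### The sandwich covariance matrix -/

/-- The matrix `M_i` of a condition with inspection time `τ` and stress vector `x`. -/
def blockM (τ : ℝ) (x : Fin (J + 1) → ℝ) (θ : Param J) : Matrix (Idx J) (Idx J) ℝ :=
  let β := shape x θ
  let l := Real.log (τ / scale x θ)
  Matrix.fromBlocks
    (β ^ 2 • vecMulVec x x) ((-l * β ^ 2) • vecMulVec x x)
    ((-l * β ^ 2) • vecMulVec x x) ((l * β) ^ 2 • vecMulVec x x)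

/-- The matrix `J_γ(θ)`, where `w i` is the proportion of devices under condition `i`. -/
def matJ (γ : ℝ) (τ : Fin I → ℝ) (x : Fin I → Fin (J + 1) → ℝ) (w : Fin I → ℝ) (θ : Param J) :
    Matrix (Idx J) (Idx J) ℝ :=
  ∑ i,
    let F := failProb (τ i) (x i) θ
    let R := relProb (τ i) (x i) θ
    (w i * (R * F) ^ 2 * (F ^ (γ - 1) + R ^ (γ - 1))) • blockM (τ i) (x i) θ

/-- The matrix `K_γ(θ)`, where `w i` is the proportion of devices under condition `i`. -/
def matK (γ : ℝ) (τ : Fin I → ℝ) (x : Fin I → Fin (J + 1) → ℝ) (w : Fin I → ℝ) (θ : Param J) :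
    Matrix (Idx J) (Idx J) ℝ :=
  ∑ i,
    let F := failProb (τ i) (x i) θ
    let R := relProb (τ i) (x i) θ
    (w i * (F ^ (γ - 1) + R ^ (γ - 1)) ^ 2 * F ^ 3 * R ^ 3) • blockM (τ i) (x i) θ

/-- The sandwich matrix `Σ(θ) = J_γ(θ)⁻¹ K_γ(θ) J_γ(θ)⁻¹`. -/
def sandwich (γ : ℝ) (τ : Fin I → ℝ) (x : Fin I → Fin (J + 1) → ℝ) (w : Fin I → ℝ)
    (θ : Param J) : Matrix (Idx J) (Idx J) ℝ :=
  (matJ γ τ x w θ)⁻¹ * matK γ τ x w θ * (matJ γ τ x w θ)⁻¹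

/-! ### The Wald-type statistic -/

/-- The `2(J+1) × r` matrix `M(θ) = ∂ m(θ)ᵀ / ∂ θ`. -/
def gradMatrix {r : ℕ} (m : Param J → Fin r → ℝ) (θ : Param J) : Matrix (Idx J) (Fin r) ℝ :=
  Matrix.of fun j k => fderiv ℝ m θ (Pi.single j 1) k

/-- The Wald-type statistic `K m(θ)ᵀ (M(θ)ᵀ Σ(θ) M(θ))⁻¹ m(θ)` at a value `θ` of the estimator,
in an experiment with `K i` devices under condition `i`. -/
def waldStat {r : ℕ} (γ : ℝ) (τ : Fin I → ℝ) (x : Fin I → Fin (J + 1) → ℝ)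
    (m : Param J → Fin r → ℝ) (K : Fin I → ℕ) (θ : Param J) : ℝ :=
  total K * (m θ ⬝ᵥ
    (((gradMatrix m θ)ᵀ * sandwich γ τ x (proportion K) θ * gradMatrix m θ)⁻¹ *ᵥ m θ))

end Experiment

/-! ### The chi-square law -/

/-- The chi-square law with `r` degrees of freedom: the law of the sum of the squares of `r`
independent standard normal variables. -/
def chiSquare (r : ℕ) : Measure ℝ :=
  (Measure.pi fun _ : Fin r => gaussianReal 0 1).map fun z => ∑ k, z k ^ 2

instance isProbabilityMeasure_chiSquare (r : ℕ) : IsProbabilityMeasure (chiSquare r) := by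
  unfold chiSquare
  exact Measure.isProbabilityMeasure_map
    (Measurable.aemeasurable (by fun_prop))

/-- The upper `α`-quantile of the chi-square law with `r` degrees of freedom. -/
def chiSquareQuantile (r : ℕ) (α : ℝ) : ℝ := sInf {c : ℝ | (chiSquare r).real (Set.Ioi c) ≤ α}

end

end OneShot

open OneShot

namespace OneShot

/-! ### The density power divergence between Bernoulli laws -/

/-! The argument separates analysis from probability. Let `z` be the vector of standardized failure
counts. All the analysis takes place where `‖z‖ ≤ R` for a fixed `R`; there the observed frequencies
are within `O(K^{-1/2})` of the true failure probabilities, and every estimate is deterministic and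
uniform in the data.

The divergence dominates a multiple of `(q - p) ^ 2` (`sq_le_dpd`). With identifiability this makes
`θ₀` beat every distant parameter, so minimizers exist eventually and converge to `θ₀`, although `Θ`
need not be compact. The minimizer is then interior and solves the estimating equation, whose
linearization at `θ₀` (`linearization`) gives `√K (θ̂ - θ₀) = -J⁻¹ G z + o(1)`, where `G = rootK`
satisfies `G Gᵀ = K_γ`. If `m θ₀ = 0`, the delta method yields `√K m(θ̂) = B z + o(1)` with `B Bᵀ =
Mᵀ Σ M`, so the statistic is `limitForm B z + o(1)` (`waldStat_sub_limitForm`). If `m θ₀ ≠ 0`, the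
quadratic form in `m(θ̂)` has a positive limit, and the factor `K` drives the statistic to infinity
(`waldStat_tendsto_atTop`).

The probability is brief. The central limit theorem in each condition, together with independence,
makes `z` converge in law to a standard Gaussian vector; hence `z` is tight, and the restriction to
`‖z‖ ≤ R` costs arbitrarily little probability. Finally `(B Bᵀ)^{-1/2} B` has orthonormal rows, so
`limitForm B` of a standard Gaussian vector is a sum of `r` squared independent standard normals
(`map_limitForm`). The chi-square law has no atoms for `r > 0`, which turns convergence in law into
convergence of the rejection probability to `α`. -/

lemma dpd_self (γ p : ℝ) (hp₀ : 0 < p) (hp₁ : p < 1) : dpd γ p (1 - p) p (1 - p) = 0 := by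
  have hp₂ : 0 < 1 - p := by linarith
  unfold dpd
  split_ifs with h
  · simp [div_self hp₀.ne', div_self hp₂.ne']
  · rw [Real.rpow_add_one hp₀.ne', Real.rpow_add_one hp₂.ne']
    field_simp
    ring

/-- The same derivative formula serves the Kullback-Leibler case and the power case, so the
estimating equation needs no case distinction on `γ`. -/
lemma hasDerivAt_dpd (γ p q : ℝ) (hp₀ : 0 < p) (hp₁ : p < 1) (hq₀ : 0 < q) (hq₁ : q < 1) :
    HasDerivAt (fun q => dpd γ p (1 - p) q (1 - q))
      ((γ + 1) * ((q - p) * (q ^ (γ - 1) + (1 - q) ^ (γ - 1)))) q := by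
  have hp₂ : 0 < 1 - p := by linarith
  have hq₂ : 0 < 1 - q := by linarith
  have hsub : HasDerivAt (fun q : ℝ => 1 - q) (-1) q := by
    simpa using (hasDerivAt_id q).const_sub 1
  unfold dpd
  split_ifs with h
  · have h₁ : HasDerivAt (fun q : ℝ => p * Real.log (p / q)) (p * (-(p / q ^ 2) / (p / q))) q := by
      refine HasDerivAt.const_mul p (HasDerivAt.log ?_ (div_pos hp₀ hq₀).ne')
      refine ((hasDerivAt_inv hq₀.ne').const_mul p).congr_deriv ?_
      rw [mul_neg, div_eq_mul_inv]
    have h₂ : HasDerivAt (fun q : ℝ => (1 - p) * Real.log ((1 - p) / (1 - q)))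
        ((1 - p) * (((1 - p) / (1 - q) ^ 2) / ((1 - p) / (1 - q)))) q := by
      refine HasDerivAt.const_mul (1 - p) (HasDerivAt.log ?_ (div_pos hp₂ hq₂).ne')
      simpa [div_eq_mul_inv] using (hsub.inv hq₂.ne').const_mul (1 - p)
    refine (h₁.add h₂).congr_deriv ?_
    subst h
    rw [zero_sub, Real.rpow_neg_one, Real.rpow_neg_one]
    field_simp
    ring
  · have hpow (a : ℝ) : HasDerivAt (fun q : ℝ => q ^ a) (a * q ^ (a - 1)) q :=
      Real.hasDerivAt_rpow_const (Or.inl hq₀.ne')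
    have hpow' (a : ℝ) : HasDerivAt (fun q : ℝ => (1 - q) ^ a) (-(a * (1 - q) ^ (a - 1))) q := by
      refine (hsub.rpow_const (p := a) (Or.inl hq₂.ne')).congr_deriv ?_
      ring
    have hd := ((((hpow (γ + 1)).add (hpow' (γ + 1))).sub
      ((((hpow γ).const_mul p).add ((hpow' γ).const_mul (1 - p))).const_mul
        ((γ + 1) / γ))).add_const (1 / γ * (p ^ (γ + 1) + (1 - p) ^ (γ + 1))))
    refine hd.congr_deriv ?_
    have e₁ : q ^ γ = q ^ (γ - 1) * q := by
      rw [← Real.rpow_add_one hq₀.ne', sub_add_cancel]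
    have e₂ : (1 - q) ^ γ = (1 - q) ^ (γ - 1) * (1 - q) := by
      rw [← Real.rpow_add_one hq₂.ne', sub_add_cancel]
    rw [add_sub_cancel_right, e₁, e₂]
    field_simp
    ring

/-- For `γ ≤ 1` each power is already at least `1`; for `γ ≥ 1` the larger of `q` and `1 - q` is at
least `1/2`. -/
lemma half_rpow_le_weight (γ q : ℝ) (hγ : 0 ≤ γ) (hq₀ : 0 < q) (hq₁ : q < 1) :
    (1 / 2 : ℝ) ^ γ ≤ q ^ (γ - 1) + (1 - q) ^ (γ - 1) := by
  have hq₂ : 0 < 1 - q := by linarith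
  have n₁ : 0 ≤ q ^ (γ - 1) := Real.rpow_nonneg hq₀.le _
  have n₂ : 0 ≤ (1 - q) ^ (γ - 1) := Real.rpow_nonneg hq₂.le _
  rcases le_total γ 1 with h | h
  · have h₁ : 1 ≤ q ^ (γ - 1) :=
      Real.one_le_rpow_of_pos_of_le_one_of_nonpos hq₀ hq₁.le (by linarith)
    have h₂ : (1 / 2 : ℝ) ^ γ ≤ 1 := Real.rpow_le_one (by norm_num) (by norm_num) hγ
    linarith
  · have h₁ : (1 / 2 : ℝ) ^ γ ≤ (1 / 2 : ℝ) ^ (γ - 1) :=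
      Real.rpow_le_rpow_of_exponent_ge (by norm_num) (by norm_num) (by linarith)
    rcases le_total (1 / 2) q with hq | hq
    · have := Real.rpow_le_rpow (by norm_num) hq (sub_nonneg.2 h)
      linarith
    · have : (1 / 2 : ℝ) ^ (γ - 1) ≤ (1 - q) ^ (γ - 1) :=
        Real.rpow_le_rpow (by norm_num) (by linarith) (sub_nonneg.2 h)
      linarith

/-- The difference of the two sides vanishes at `q = p`, and its derivative in `q` is `q - p` times
a nonnegative factor. The mean value theorem on either side of `p` concludes. -/
lemma sq_le_dpd (γ p q : ℝ) (hγ : 0 ≤ γ) (hp₀ : 0 < p) (hp₁ : p < 1) (hq₀ : 0 < q) (hq₁ : q < 1) :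
    (1 / 2 : ℝ) ^ γ / 2 * (q - p) ^ 2 ≤ dpd γ p (1 - p) q (1 - q) := by
  set c : ℝ := (1 / 2 : ℝ) ^ γ with hc
  have hc₀ : 0 ≤ c := by positivity
  set f : ℝ → ℝ := fun q => dpd γ p (1 - p) q (1 - q) - c / 2 * (q - p) ^ 2 with hf
  set D : ℝ → ℝ := fun q => (q - p) * ((γ + 1) * (q ^ (γ - 1) + (1 - q) ^ (γ - 1)) - c) with hD
  have hder : ∀ t, 0 < t → t < 1 → HasDerivAt f (D t) t := by
    intro t ht₀ ht₁
    have h₂ : HasDerivAt (fun q : ℝ => c / 2 * (q - p) ^ 2) (c * (t - p)) t := by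
      refine ((((hasDerivAt_id t).sub_const p).pow 2).const_mul (c / 2)).congr_deriv ?_
      simp
      ring
    refine ((hasDerivAt_dpd γ p t hp₀ hp₁ ht₀ ht₁).sub h₂).congr_deriv ?_
    simp only [hD]
    ring
  have hpos : ∀ t, 0 < t → t < 1 → 0 ≤ (γ + 1) * (t ^ (γ - 1) + (1 - t) ^ (γ - 1)) - c := by
    intro t ht₀ ht₁
    have := half_rpow_le_weight γ t hγ ht₀ ht₁
    nlinarith
  have hfp : f p = 0 := by simp [hf, dpd_self γ p hp₀ hp₁]
  suffices h : 0 ≤ f q by simp only [hf] at h; linarith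
  rcases lt_trichotomy p q with h | h | h
  · obtain ⟨t, ht, hs⟩ := exists_hasDerivAt_eq_slope f D h
      (fun t ht => (hder t (hp₀.trans_le ht.1) (ht.2.trans_lt hq₁)).continuousAt.continuousWithinAt)
      (fun t ht => hder t (hp₀.trans ht.1) (ht.2.trans hq₁))
    have h₁ : 0 ≤ D t := mul_nonneg (sub_nonneg.2 ht.1.le)
      (hpos t (hp₀.trans ht.1) (ht.2.trans hq₁))
    rw [hs, hfp, sub_zero] at h₁
    exact (div_nonneg_iff.1 h₁).elim (fun h => h.1) fun h' => by linarith [h'.2]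
  · rw [← h, hfp]
  · obtain ⟨t, ht, hs⟩ := exists_hasDerivAt_eq_slope f D h
      (fun t ht => (hder t (hq₀.trans_le ht.1) (ht.2.trans_lt hp₁)).continuousAt.continuousWithinAt)
      (fun t ht => hder t (hq₀.trans ht.1) (ht.2.trans hp₁))
    have h₁ : D t ≤ 0 := mul_nonpos_of_nonpos_of_nonneg (sub_nonpos.2 ht.2.le)
      (hpos t (hq₀.trans ht.1) (ht.2.trans hp₁))
    rw [hs, hfp, zero_sub, neg_div, neg_nonpos] at h₁
    exact (div_nonneg_iff.1 h₁).elim (fun h => h.1) fun h' => by linarith [h'.2]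

lemma tendsto_dpd_left (γ q : ℝ) (hq₀ : 0 < q) (hq₁ : q < 1) :
    Tendsto (fun p => dpd γ p (1 - p) q (1 - q)) (𝓝 q) (𝓝 0) := by
  have hq₂ : 0 < 1 - q := by linarith
  have h : ContinuousAt (fun p => dpd γ p (1 - p) q (1 - q)) q := by
    unfold dpd
    split_ifs with h
    · have h₁ : q / q ≠ 0 := (div_pos hq₀ hq₀).ne'
      have h₂ : (1 - q) / (1 - q) ≠ 0 := (div_pos hq₂ hq₂).ne'
      fun_prop (disch := assumption)
    · have h₁ : ContinuousAt (fun p : ℝ => p ^ (γ + 1)) q :=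
        continuousAt_id.rpow_const (Or.inl hq₀.ne')
      have h₂ : ContinuousAt (fun p : ℝ => (1 - p) ^ (γ + 1)) q :=
        (continuousAt_const.sub continuousAt_id).rpow_const (Or.inl hq₂.ne')
      fun_prop
  simpa only [dpd_self γ q hq₀ hq₁] using h.tendsto

lemma continuousAt_dpd_right (γ p q : ℝ) (hp₀ : 0 < p) (hp₁ : p < 1) (hq₀ : 0 < q) (hq₁ : q < 1) :
    ContinuousAt (fun q => dpd γ p (1 - p) q (1 - q)) q :=
  (hasDerivAt_dpd γ p q hp₀ hp₁ hq₀ hq₁).continuousAt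

/-! ### The failure probability and its gradient -/

section Model

variable {J : ℕ} (τ : ℝ) (x : Fin (J + 1) → ℝ)

/-- The direction `v` for which `blockM = v vᵀ` and the gradient of the failure probability is
`-F R v`. -/
noncomputable def direction (θ : Param J) : Param J :=
  Sum.elim (fun j => shape x θ * x j) (fun j => -Real.log (τ / scale x θ) * shape x θ * x j)

lemma blockM_eq (θ : Param J) : blockM τ x θ = vecMulVec (direction τ x θ) (direction τ x θ) := by
  ext (i | i) (j | j) <;> simp [blockM, direction, vecMulVec_apply] <;> ring

lemma scale_pos (θ : Param J) : 0 < scale x θ := Real.exp_pos _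

lemma log_div_scale (hτ : 0 < τ) (θ : Param J) :
    Real.log (τ / scale x θ) = Real.log τ - ∑ j, θ (Sum.inl j) * x j := by
  rw [Real.log_div hτ.ne' (scale_pos x θ).ne', scale, Real.log_exp]

/-- The logit of `F` is `β (log τ - log α)`, with `log α` linear in the parameter. The sigmoid
derivative then supplies the factor `F R` in the gradient. -/
lemma failProb_eq_sigmoid (hτ : 0 < τ) (θ : Param J) :
    failProb τ x θ = Real.sigmoid (shape x θ * (Real.log τ - ∑ j, θ (Sum.inl j) * x j)) := by
  have hs := scale_pos x θ
  rw [failProb, logLogisticCDF, Real.sigmoid_def, ← log_div_scale τ x hτ,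
    show -(shape x θ * Real.log (τ / scale x θ)) = Real.log (scale x θ / τ) * shape x θ by
      rw [Real.log_div hτ.ne' hs.ne', Real.log_div hs.ne' hτ.ne']; ring,
    ← Real.rpow_def_of_pos (div_pos hs hτ), Real.div_rpow hs.le hτ.le]
  have := Real.rpow_pos_of_pos hτ (shape x θ)
  field_simp

lemma failProb_pos (hτ : 0 < τ) (θ : Param J) : 0 < failProb τ x θ := by
  rw [failProb_eq_sigmoid τ x hτ]; exact Real.sigmoid_pos _

lemma failProb_lt_one (hτ : 0 < τ) (θ : Param J) : failProb τ x θ < 1 := by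
  rw [failProb_eq_sigmoid τ x hτ]; exact Real.sigmoid_lt_one _

lemma relProb_eq (hτ : 0 < τ) (θ : Param J) : relProb τ x θ = 1 - failProb τ x θ := by
  have h₁ := Real.rpow_pos_of_pos hτ (shape x θ)
  have h₂ := Real.rpow_pos_of_pos (scale_pos x θ) (shape x θ)
  rw [relProb, failProb, logLogisticCDF, logLogisticRel]
  field_simp
  ring

lemma relProb_pos (hτ : 0 < τ) (θ : Param J) : 0 < relProb τ x θ := by
  rw [relProb_eq τ x hτ]; linarith [failProb_lt_one τ x hτ θ]

/-- The linear form `h ↦ v ⬝ h` as a continuous linear map. -/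
noncomputable def dotCLM {ι : Type*} [Fintype ι] (v : ι → ℝ) : (ι → ℝ) →L[ℝ] ℝ :=
  ∑ j, v j • ContinuousLinearMap.proj (R := ℝ) (φ := fun _ : ι => ℝ) j

lemma dotCLM_apply {ι : Type*} [Fintype ι] (v h : ι → ℝ) : dotCLM v h = v ⬝ᵥ h := by
  simp [dotCLM, dotProduct]

lemma hasFDerivAt_failProb (hτ : 0 < τ) (θ : Param J) :
    HasFDerivAt (failProb τ x)
      (-(failProb τ x θ * relProb τ x θ) • dotCLM (direction τ x θ)) θ := by
  have hl (s : Fin (J + 1) → Idx J) : HasFDerivAt (fun θ : Param J => ∑ j, θ (s j) * x j)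
      (∑ j, x j • ContinuousLinearMap.proj (R := ℝ) (φ := fun _ : Idx J => ℝ) (s j)) θ :=
    HasFDerivAt.fun_sum fun j _ => (hasFDerivAt_apply (s j) θ).mul_const (x j)
  have hsh : HasFDerivAt (shape x) _ θ := (hl Sum.inr).exp
  have hu := hsh.mul ((hl Sum.inl).const_sub (Real.log τ))
  have hF := (Real.hasDerivAt_sigmoid
    (shape x θ * (Real.log τ - ∑ j, θ (Sum.inl j) * x j))).comp_hasFDerivAt θ hu
  rw [show failProb τ x =
    Real.sigmoid ∘ (shape x * fun θ => Real.log τ - ∑ j, θ (Sum.inl j) * x j) from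
      funext fun θ => failProb_eq_sigmoid τ x hτ θ]
  refine hF.congr_fderiv ?_
  rw [relProb_eq τ x hτ, failProb_eq_sigmoid τ x hτ]
  ext h
  simp only [_root_.smul_apply, _root_.add_apply, dotCLM_apply,
    _root_.neg_apply, _root_.sum_apply, ContinuousLinearMap.proj_apply,
    direction, dotProduct, Fintype.sum_sum_type, Sum.elim_inl, Sum.elim_inr, smul_eq_mul,
    log_div_scale τ x hτ, Function.comp, Pi.mul_apply, shape]
  have e₁ : ∀ c : ℝ, ∑ j, c * x j * h (Sum.inl j) = c * ∑ j, x j * h (Sum.inl j) := fun c => by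
    simp [Finset.mul_sum, mul_assoc]
  have e₂ : ∀ c : ℝ, ∑ j, c * x j * h (Sum.inr j) = c * ∑ j, x j * h (Sum.inr j) := fun c => by
    simp [Finset.mul_sum, mul_assoc]
  rw [e₁, e₂]
  ring

lemma continuous_failProb (hτ : 0 < τ) : Continuous (failProb τ x) :=
  continuous_iff_continuousAt.2 fun θ => (hasFDerivAt_failProb τ x hτ θ).continuousAt

lemma continuous_relProb (hτ : 0 < τ) : Continuous (relProb τ x) := by
  rw [show relProb τ x = fun θ => 1 - failProb τ x θ from funext fun θ => relProb_eq τ x hτ θ]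
  exact continuous_const.sub (continuous_failProb τ x hτ)

lemma continuous_direction (hτ : 0 < τ) : Continuous (direction τ x) := by
  have h : Continuous (shape x) := by unfold shape; fun_prop
  have h' : Continuous fun θ => Real.log (τ / scale x θ) := by
    simp only [log_div_scale τ x hτ]; fun_prop
  refine continuous_pi fun j => ?_
  rcases j with j | j <;> simp only [direction, Sum.elim_inl, Sum.elim_inr] <;> fun_prop

end Model

/-! ### Consistency of the minimizers -/

section Estimator

variable {I J : ℕ} {ι : Type*} {l : Filter ι}

/-- The objective function of the estimator, with weights `w` and relative frequencies `p`. -/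
noncomputable def objective (γ : ℝ) (τ : Fin I → ℝ) (x : Fin I → Fin (J + 1) → ℝ)
    (w p : Fin I → ℝ) (θ : Param J) : ℝ :=
  ∑ i, w i * dpd γ (p i) (1 - p i) (failProb (τ i) (x i) θ) (1 - failProb (τ i) (x i) θ)

lemma weightedDPD_eq_objective (γ : ℝ) (τ : Fin I → ℝ) (hτ : ∀ i, 0 < τ i)
    (x : Fin I → Fin (J + 1) → ℝ) (K n : Fin I → ℕ) :
    weightedDPD γ τ x K n = objective γ τ x (proportion K) (fun i => (n i : ℝ) / K i) := by
  ext θ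
  simp only [weightedDPD, objective, relProb_eq _ _ (hτ _)]

variable (γ : ℝ) (τ : Fin I → ℝ) (x : Fin I → Fin (J + 1) → ℝ)

lemma continuous_objective (hτ : ∀ i, 0 < τ i) (w p : Fin I → ℝ) (hp₀ : ∀ i, 0 < p i)
    (hp₁ : ∀ i, p i < 1) : Continuous (objective γ τ x w p) := by
  refine continuous_finsetSum _ fun i _ => continuous_const.mul
    (continuous_iff_continuousAt.2 fun θ => ?_)
  exact (continuousAt_dpd_right γ (p i) _ (hp₀ i) (hp₁ i) (failProb_pos _ _ (hτ i) θ)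
    (failProb_lt_one _ _ (hτ i) θ)).comp (continuous_failProb (τ i) (x i) (hτ i)).continuousAt

lemma eventually_mem_Ioo_of_tendsto (hτ : ∀ i, 0 < τ i) {θ₀ : Param J} {p : ι → Fin I → ℝ}
    (hp : Tendsto p l (𝓝 fun i => failProb (τ i) (x i) θ₀)) :
    ∀ᶠ a in l, (∀ i, 0 < p a i) ∧ ∀ i, p a i < 1 := by
  rw [tendsto_pi_nhds] at hp
  refine (eventually_all.2 fun i => ?_).and (eventually_all.2 fun i => ?_)
  · exact (hp i).eventually_const_lt (failProb_pos _ _ (hτ i) θ₀)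
  · exact (hp i).eventually_lt_const (failProb_lt_one _ _ (hτ i) θ₀)

/-- The objective at `θ₀` tends to `0`, whereas at a distant `θ` some single condition keeps its
contribution above a fixed positive bound. -/
lemma eventually_objective_lt (hγ : 0 ≤ γ) (hτ : ∀ i, 0 < τ i) {Θ : Set (Param J)} {θ₀ : Param J}
    (hident : ∀ ε > 0, ∃ δ > 0, ∀ θ ∈ Θ, ε ≤ dist θ θ₀ →
      ∃ i, δ ≤ |failProb (τ i) (x i) θ - failProb (τ i) (x i) θ₀|)
    {w : Fin I → ℝ} (hw : ∀ i, 0 < w i) {w' p : ι → Fin I → ℝ} (hw' : Tendsto w' l (𝓝 w))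
    (hp : Tendsto p l (𝓝 fun i => failProb (τ i) (x i) θ₀)) {ε : ℝ} (hε : 0 < ε) :
    ∀ᶠ a in l, ∀ θ ∈ Θ, ε ≤ dist θ θ₀ →
      objective γ τ x (w' a) (p a) θ₀ < objective γ τ x (w' a) (p a) θ := by
  obtain ⟨δ, hδ, hsep⟩ := hident ε hε
  set c : ℝ := (1 / 2 : ℝ) ^ γ / 2 with hc
  have hc₀ : 0 < c := by positivity
  have hlim : Tendsto (fun a => objective γ τ x (w' a) (p a) θ₀) l (𝓝 0) := by
    have : Tendsto (fun a => objective γ τ x (w' a) (p a) θ₀) l (𝓝 (∑ i, w i * 0)) :=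
      tendsto_finsetSum _ fun i _ => (tendsto_pi_nhds.1 hw' i).mul
        ((tendsto_dpd_left γ _ (failProb_pos _ _ (hτ i) θ₀) (failProb_lt_one _ _ (hτ i) θ₀)).comp
          (tendsto_pi_nhds.1 hp i))
    simpa using this
  -- The separating condition `i` depends on `θ`, so the threshold has to be met for all `i`
  -- simultaneously.
  have h₁ : ∀ᶠ a in l, ∀ i, objective γ τ x (w' a) (p a) θ₀ < w i / 2 * (c * (δ / 2) ^ 2) :=
    eventually_all.2 fun i => hlim.eventually_lt_const (by have := hw i; positivity)
  have h₂ : ∀ᶠ a in l, ∀ i, w i / 2 < w' a i :=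
    eventually_all.2 fun i => (tendsto_pi_nhds.1 hw' i).eventually_const_lt (half_lt_self (hw i))
  have h₃ : ∀ᶠ a in l, ∀ i, dist (p a i) (failProb (τ i) (x i) θ₀) < δ / 2 :=
    eventually_all.2 fun i =>
      (tendsto_pi_nhds.1 hp i).eventually (Metric.ball_mem_nhds _ (half_pos hδ))
  filter_upwards [h₁, h₂, h₃, eventually_mem_Ioo_of_tendsto τ x hτ hp]
    with a h₁ h₂ h₃ ⟨hp₀, hp₁⟩ θ hθ hd
  obtain ⟨i, hi⟩ := hsep θ hθ hd
  have hquad : ∀ i, c * (failProb (τ i) (x i) θ - p a i) ^ 2 ≤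
      dpd γ (p a i) (1 - p a i) (failProb (τ i) (x i) θ) (1 - failProb (τ i) (x i) θ) := fun i =>
    sq_le_dpd γ _ _ hγ (hp₀ i) (hp₁ i) (failProb_pos _ _ (hτ i) θ) (failProb_lt_one _ _ (hτ i) θ)
  have hwpos : ∀ i, 0 < w' a i := fun i => (half_pos (hw i)).trans (h₂ i)
  have hgap : (δ / 2) ^ 2 ≤ (failProb (τ i) (x i) θ - p a i) ^ 2 := by
    rw [sq_le_sq, abs_of_pos (half_pos hδ)]
    have h₄ := h₃ i
    rw [Real.dist_eq] at h₄
    have := abs_sub_le (failProb (τ i) (x i) θ) (p a i) (failProb (τ i) (x i) θ₀)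
    linarith
  calc objective γ τ x (w' a) (p a) θ₀ < w i / 2 * (c * (δ / 2) ^ 2) := h₁ i
    _ ≤ w' a i * (c * (failProb (τ i) (x i) θ - p a i) ^ 2) := by
        have := (h₂ i).le
        have := (hwpos i).le
        gcongr
    _ ≤ w' a i * dpd γ (p a i) (1 - p a i) (failProb (τ i) (x i) θ)
          (1 - failProb (τ i) (x i) θ) := mul_le_mul_of_nonneg_left (hquad i) (hwpos i).le
    _ ≤ objective γ τ x (w' a) (p a) θ :=
        Finset.single_le_sum (f := fun i => w' a i * dpd γ (p a i) (1 - p a i)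
          (failProb (τ i) (x i) θ) (1 - failProb (τ i) (x i) θ))
          (fun i _ => mul_nonneg (hwpos i).le ((by positivity : (0 : ℝ) ≤ _).trans (hquad i)))
          (Finset.mem_univ i)

/-- A minimizer over a small closed ball inside `Θ` does at least as well as `θ₀`, and `θ₀` beats
everything outside the ball. Hence it minimizes over all of `Θ`. -/
lemma eventually_exists_isMinOn (hγ : 0 ≤ γ) (hτ : ∀ i, 0 < τ i) {Θ : Set (Param J)}
    {θ₀ : Param J} (hθ₀ : θ₀ ∈ interior Θ)
    (hident : ∀ ε > 0, ∃ δ > 0, ∀ θ ∈ Θ, ε ≤ dist θ θ₀ →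
      ∃ i, δ ≤ |failProb (τ i) (x i) θ - failProb (τ i) (x i) θ₀|)
    {w : Fin I → ℝ} (hw : ∀ i, 0 < w i) {w' p : ι → Fin I → ℝ} (hw' : Tendsto w' l (𝓝 w))
    (hp : Tendsto p l (𝓝 fun i => failProb (τ i) (x i) θ₀)) :
    ∀ᶠ a in l, ∃ θ ∈ Θ, IsMinOn (objective γ τ x (w' a) (p a)) Θ θ := by
  obtain ⟨ε, hε, hball⟩ := Metric.nhds_basis_closedBall.mem_iff.1 (mem_interior_iff_mem_nhds.1 hθ₀)
  filter_upwards [eventually_objective_lt γ τ x hγ hτ hident hw hw' hp hε,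
    eventually_mem_Ioo_of_tendsto τ x hτ hp] with a ha ⟨hp₀, hp₁⟩
  obtain ⟨θ, hθ, hmin⟩ := (isCompact_closedBall θ₀ ε).exists_isMinOn
    ⟨θ₀, Metric.mem_closedBall_self hε.le⟩ (continuous_objective γ τ x hτ _ _ hp₀ hp₁).continuousOn
  refine ⟨θ, hball hθ, fun θ' hθ' => ?_⟩
  rcases le_total (dist θ' θ₀) ε with h | h
  · exact hmin h
  · exact (hmin (Metric.mem_closedBall_self hε.le)).trans (ha θ' hθ' h).le

lemma tendsto_of_isMinOn (hγ : 0 ≤ γ) (hτ : ∀ i, 0 < τ i) {Θ : Set (Param J)}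
    {θ₀ : Param J} (hθ₀ : θ₀ ∈ interior Θ)
    (hident : ∀ ε > 0, ∃ δ > 0, ∀ θ ∈ Θ, ε ≤ dist θ θ₀ →
      ∃ i, δ ≤ |failProb (τ i) (x i) θ - failProb (τ i) (x i) θ₀|)
    {w : Fin I → ℝ} (hw : ∀ i, 0 < w i) {w' p : ι → Fin I → ℝ} (hw' : Tendsto w' l (𝓝 w))
    (hp : Tendsto p l (𝓝 fun i => failProb (τ i) (x i) θ₀)) {θ : ι → Param J}
    (hθ : ∀ᶠ a in l, θ a ∈ Θ ∧ IsMinOn (objective γ τ x (w' a) (p a)) Θ (θ a)) :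
    Tendsto θ l (𝓝 θ₀) := by
  rw [Metric.tendsto_nhds]
  intro ε hε
  filter_upwards [eventually_objective_lt γ τ x hγ hτ hident hw hw' hp hε, hθ] with a ha ⟨h₁, h₂⟩
  by_contra! h
  exact (ha _ h₁ h).not_ge (h₂ (interior_subset hθ₀))

/-! ### The estimating equation -/

/-- The factor `(F^{γ-1} + R^{γ-1}) F R` of the estimating function. -/
noncomputable def scoreFactor (τ : ℝ) (x : Fin (J + 1) → ℝ) (θ : Param J) : ℝ :=
  (failProb τ x θ ^ (γ - 1) + relProb τ x θ ^ (γ - 1)) * (failProb τ x θ * relProb τ x θ)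

lemma scoreFactor_pos {τ : ℝ} (hτ : 0 < τ) (x : Fin (J + 1) → ℝ) (θ : Param J) :
    0 < scoreFactor γ τ x θ := by
  have h₁ := failProb_pos τ x hτ θ
  have h₂ := relProb_pos τ x hτ θ
  have := Real.rpow_pos_of_pos h₁ (γ - 1)
  have := Real.rpow_pos_of_pos h₂ (γ - 1)
  unfold scoreFactor
  positivity

lemma continuous_scoreFactor {τ : ℝ} (hτ : 0 < τ) (x : Fin (J + 1) → ℝ) :
    Continuous (scoreFactor γ τ x : Param J → ℝ) := by
  have h₁ := continuous_failProb τ x hτ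
  have h₂ := continuous_relProb τ x hτ
  exact ((h₁.rpow_const fun θ => Or.inl (failProb_pos τ x hτ θ).ne').add
    (h₂.rpow_const fun θ => Or.inl (relProb_pos τ x hτ θ).ne')).mul (h₁.mul h₂)

lemma estimating_equation (hγ : 0 ≤ γ) (hτ : ∀ i, 0 < τ i) {Θ : Set (Param J)} {w p : Fin I → ℝ}
    (hp₀ : ∀ i, 0 < p i) (hp₁ : ∀ i, p i < 1) {θ : Param J} (hθ : θ ∈ interior Θ)
    (hmin : IsMinOn (objective γ τ x w p) Θ θ) :
    ∑ i, ((failProb (τ i) (x i) θ - p i) * (w i * scoreFactor γ (τ i) (x i) θ)) •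
      direction (τ i) (x i) θ = 0 := by
  have hder : HasFDerivAt (objective γ τ x w p) _ θ := HasFDerivAt.fun_sum fun i _ =>
    ((hasDerivAt_dpd γ (p i) _ (hp₀ i) (hp₁ i) (failProb_pos _ _ (hτ i) θ)
      (failProb_lt_one _ _ (hτ i) θ)).comp_hasFDerivAt θ
        (hasFDerivAt_failProb (τ i) (x i) (hτ i) θ)).const_mul (w i)
  have h0 := (hmin.isLocalMin (mem_interior_iff_mem_nhds.1 hθ)).hasFDerivAt_eq_zero hder
  ext j
  have h1 := congrArg (fun L : Param J →L[ℝ] ℝ => L (Pi.single j 1)) h0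
  simp only [_root_.sum_apply, _root_.smul_apply, dotCLM_apply, dotProduct_single,
    smul_eq_mul, mul_one, _root_.zero_apply] at h1
  simp only [Finset.sum_apply, Pi.smul_apply, smul_eq_mul, Pi.zero_apply]
  -- Every summand of the gradient carries this common factor: `γ + 1` from the divergence, the sign
  -- from the gradient of `F`.
  have hγ1 : -(γ + 1) ≠ 0 := by linarith
  refine (mul_eq_zero.1 (?_ : -(γ + 1) * _ = 0)).resolve_left hγ1
  rw [Finset.mul_sum, ← h1]
  refine Finset.sum_congr rfl fun i _ => ?_
  simp only [scoreFactor, relProb_eq _ _ (hτ i)]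
  ring

/-! ### Linearization of the estimator -/

/-- The summand of condition `i` in the estimating function, per unit of `F_i - p_i`. -/
noncomputable def scoreVec (w : Fin I → ℝ) (θ : Param J) (i : Fin I) : Param J :=
  (w i * scoreFactor γ (τ i) (x i) θ) • direction (τ i) (x i) θ

/-- `matJ` is, up to sign, the derivative at `θ` of the estimating function with its score vectors
frozen; this is how it enters the linearization. -/
lemma matJ_mulVec (w : Fin I → ℝ) (θ h : Param J) :
    matJ γ τ x w θ *ᵥ h = ∑ i, (failProb (τ i) (x i) θ * relProb (τ i) (x i) θ *
      (direction (τ i) (x i) θ ⬝ᵥ h)) • scoreVec γ τ x w θ i := by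
  rw [matJ, sum_mulVec]
  refine Finset.sum_congr rfl fun i _ => ?_
  rw [smul_mulVec, blockM_eq, vecMulVec_mulVec, scoreVec, scoreFactor]
  ext j
  simp
  ring

-- Expanding the estimating equation at `θ₀` gives `A h + ∑ (p - F) C = o(‖h‖ + ‖t‖)` for `h = θ -
-- θ₀`. Inverting `A` first bounds `h` by `O(t)`, and this bound then improves the error to `o(t)`.
-- The filter is arbitrary so that it can later encode uniformity over sample points.
open Asymptotics in
lemma linearization (hτ : ∀ i, 0 < τ i) {w : Fin I → ℝ} {θ₀ : Param J}
    (hJ : IsUnit (matJ γ τ x w θ₀).det) {w' p : ι → Fin I → ℝ} (hw' : Tendsto w' l (𝓝 w))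
    {θ : ι → Param J} (hθ : Tendsto θ l (𝓝 θ₀)) {t : ι → ℝ}
    (hp : ∀ i, (fun a => p a i - failProb (τ i) (x i) θ₀) =O[l] t)
    (heq : ∀ᶠ a in l,
      ∑ i, (failProb (τ i) (x i) (θ a) - p a i) • scoreVec γ τ x (w' a) (θ a) i = 0) :
    (fun a => θ a - θ₀) =O[l] t ∧
    (fun a => θ a - θ₀ + (matJ γ τ x w θ₀)⁻¹ *ᵥ
      ∑ i, (p a i - failProb (τ i) (x i) θ₀) • scoreVec γ τ x w θ₀ i) =o[l] t := by
  set A := matJ γ τ x w θ₀ with hA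
  set F : Fin I → Param J → ℝ := fun i => failProb (τ i) (x i) with hF
  set h : ι → Param J := fun a => θ a - θ₀ with hh
  set C : Fin I → Param J := scoreVec γ τ x w θ₀ with hC
  set ρ : ι → ℝ := fun a => ‖h a‖ + ‖t a‖ with hρ
  have hhρ : h =O[l] ρ := IsBigO.of_norm_le fun a => by simp [hρ]
  have htρ : t =O[l] ρ := IsBigO.of_norm_le fun a => by simp [hρ]
  have hF₁ (i : Fin I) : (fun a => F i (θ a) - F i θ₀ + F i θ₀ * relProb (τ i) (x i) θ₀ *
      (direction (τ i) (x i) θ₀ ⬝ᵥ h a)) =o[l] h := by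
    have := (hasFDerivAt_failProb (τ i) (x i) (hτ i) θ₀).isLittleO.comp_tendsto hθ
    refine this.congr_left fun a => ?_
    simp [dotCLM_apply, hh, hF]
  have hF₂ (i : Fin I) : (fun a => F i (θ a) - F i θ₀) =O[l] h :=
    (hasFDerivAt_failProb (τ i) (x i) (hτ i) θ₀).isBigO_sub.comp_tendsto hθ
  -- No rate is needed for the weights: this difference only ever multiplies quantities that are
  -- `O(ρ)`.
  have hCt (i : Fin I) : (fun a => scoreVec γ τ x (w' a) (θ a) i - C i) =o[l]
      (fun _ => (1 : ℝ)) := by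
    rw [isLittleO_one_iff, ← sub_self (C i)]
    refine Tendsto.sub_const ?_ _
    exact ((tendsto_pi_nhds.1 hw' i).mul (((continuous_scoreFactor γ (hτ i) (x i)).tendsto _).comp
      hθ)).smul (((continuous_direction (τ i) (x i) (hτ i)).tendsto _).comp hθ)
  have hsmul (f : ι → ℝ) (c : Param J) : (fun a => f a • c) =O[l] f :=
    IsBigO.of_bound ‖c‖ (Eventually.of_forall fun a =>
      (norm_smul_le (f a) c).trans_eq (mul_comm _ _))
  set E : ι → Param J := fun a => A *ᵥ h a + ∑ i, (p a i - F i θ₀) • C i with hE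
  have hEo : E =o[l] ρ := by
    have : (fun a => ∑ i, ((F i (θ a) - F i θ₀ + F i θ₀ * relProb (τ i) (x i) θ₀ *
        (direction (τ i) (x i) θ₀ ⬝ᵥ h a)) • C i
        + (F i (θ a) - F i θ₀) • (scoreVec γ τ x (w' a) (θ a) i - C i)
        - (p a i - F i θ₀) • (scoreVec γ τ x (w' a) (θ a) i - C i))) =o[l] ρ := by
      refine IsLittleO.fun_sum fun i _ => ?_
      refine (IsLittleO.add ?_ ?_).sub ?_
      · exact (hsmul _ (C i)).trans_isLittleO ((hF₁ i).trans_isBigO hhρ)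
      · simpa using ((hF₂ i).trans hhρ).smul_isLittleO (hCt i)
      · simpa using ((hp i).trans htρ).smul_isLittleO (hCt i)
    refine this.congr' ?_ EventuallyEq.rfl
    filter_upwards [heq] with a ha
    simp only [hE]
    rw [hA, matJ_mulVec, ← sub_eq_zero, ← ha, ← Finset.sum_add_distrib, ← Finset.sum_sub_distrib]
    refine Finset.sum_congr rfl fun i _ => ?_
    module
  have he : (fun a => h a + A⁻¹ *ᵥ ∑ i, (p a i - F i θ₀) • C i) =o[l] ρ := by
    have h₁ : (fun a => A⁻¹ *ᵥ E a) =O[l] E :=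
      (LinearMap.toContinuousLinearMap (Matrix.mulVecLin A⁻¹)).isBigO_comp E l
    refine (h₁.trans_isLittleO hEo).congr_left fun a => ?_
    rw [hE, mulVec_add, mulVec_mulVec, nonsing_inv_mul _ hJ, one_mulVec]
  have hb : (fun a => A⁻¹ *ᵥ ∑ i, (p a i - F i θ₀) • C i) =O[l] t := by
    have h₁ : (fun a => ∑ i, (p a i - F i θ₀) • C i) =O[l] t := 
      IsBigO.fun_sum fun i _ => (hsmul _ (C i)).trans (hp i)
    exact ((LinearMap.toContinuousLinearMap (Matrix.mulVecLin A⁻¹)).isBigO_comp _ l).trans h₁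
  have hht : h =O[l] t := by
    obtain ⟨c, hc⟩ := hb.bound
    -- From `‖h‖ ≤ c‖t‖ + (‖h‖ + ‖t‖) / 2`, absorbing `‖h‖ / 2` into the left side.
    refine IsBigO.of_bound (2 * c + 1) ?_
    filter_upwards [hc, he.def (half_pos one_pos)] with a h₁ h₂
    have h₃ := norm_le_norm_add_norm_sub' (h a) (-(A⁻¹ *ᵥ ∑ i, (p a i - F i θ₀) • C i))
    rw [norm_neg, sub_neg_eq_add] at h₃
    rw [Real.norm_of_nonneg (show 0 ≤ ρ a by positivity)] at h₂
    simp only [hρ] at h₂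
    linarith
  exact ⟨hht, he.trans_isBigO (hht.norm_left.add (isBigO_refl t l).norm_left)⟩

end Estimator

/-! ### The asymptotic linear form of the estimator -/

section Limit

variable {I J r : ℕ} (γ : ℝ) (τ : Fin I → ℝ) (x : Fin I → Fin (J + 1) → ℝ) (w : Fin I → ℝ)

/-- Standard deviation of the failure indicator under one condition. -/
noncomputable def stdDev (τ : ℝ) (x : Fin (J + 1) → ℝ) (θ : Param J) : ℝ :=
  √(failProb τ x θ * relProb τ x θ)

lemma stdDev_pos {τ : ℝ} (hτ : 0 < τ) (x : Fin (J + 1) → ℝ) (θ : Param J) : 0 < stdDev τ x θ :=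
  Real.sqrt_pos.2 (mul_pos (failProb_pos _ _ hτ θ) (relProb_pos _ _ hτ θ))

lemma stdDev_sq {τ : ℝ} (hτ : 0 < τ) (x : Fin (J + 1) → ℝ) (θ : Param J) :
    stdDev τ x θ ^ 2 = failProb τ x θ * relProb τ x θ :=
  Real.sq_sqrt (mul_pos (failProb_pos _ _ hτ θ) (relProb_pos _ _ hτ θ)).le

/-- A square root of `matK`: the columns are the scores of the conditions, for standardized
counts. -/
noncomputable def rootK (θ : Param J) : Matrix (Idx J) (Fin I) ℝ :=
  Matrix.of fun j i => stdDev (τ i) (x i) θ / √(w i) * scoreVec γ τ x w θ i j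

lemma rootK_mul_transpose (hτ : ∀ i, 0 < τ i) (hw : ∀ i, 0 < w i) (θ : Param J) :
    rootK γ τ x w θ * (rootK γ τ x w θ)ᵀ = matK γ τ x w θ := by
  ext j k
  simp only [mul_apply, transpose_apply, rootK, of_apply, matK, Matrix.sum_apply, Matrix.smul_apply,
    blockM_eq, vecMulVec_apply, smul_eq_mul, scoreVec, Pi.smul_apply]
  refine Finset.sum_congr rfl fun i _ => ?_
  have h₁ := stdDev_sq (hτ i) (x i) θ
  have h₂ := Real.sq_sqrt (hw i).le
  have h₃ := (hw i).ne'
  rw [show ∀ s q a d e : ℝ, s / q * (a * d) * (s / q * (a * e)) = s ^ 2 / q ^ 2 * (a ^ 2 * d * e) by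
    intros; ring, h₁, h₂, scoreFactor]
  field_simp

lemma rootK_mulVec (θ : Param J) (z : Fin I → ℝ) :
    rootK γ τ x w θ *ᵥ z =
      ∑ i, (stdDev (τ i) (x i) θ / √(w i) * z i) • scoreVec γ τ x w θ i := by
  ext j
  simp only [mulVec, dotProduct, rootK, of_apply, Finset.sum_apply, Pi.smul_apply, smul_eq_mul]
  exact Finset.sum_congr rfl fun i _ => by ring

lemma matJ_transpose (θ : Param J) : (matJ γ τ x w θ)ᵀ = matJ γ τ x w θ := by
  simp only [matJ, transpose_sum, transpose_smul, blockM_eq, transpose_vecMulVec]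

/-- A vector in the kernel is orthogonal to every `direction`, hence is also annihilated by `matJ`.
-/
lemma rootK_transpose_mulVec_injective (hτ : ∀ i, 0 < τ i) (hw : ∀ i, 0 < w i) {θ : Param J}
    (hJ : IsUnit (matJ γ τ x w θ).det) : Function.Injective (rootK γ τ x w θ)ᵀ.mulVec := by
  refine (injective_iff_map_eq_zero (Matrix.mulVecLin (rootK γ τ x w θ)ᵀ)).2 fun y hy => ?_
  rw [mulVecLin_apply] at hy
  have hdir : ∀ i, direction (τ i) (x i) θ ⬝ᵥ y = 0 := fun i => by
    have h := congrFun hy i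
    simp only [mulVec, dotProduct, transpose_apply, rootK, of_apply, scoreVec, Pi.smul_apply,
      smul_eq_mul, Pi.zero_apply] at h
    have h₁ := stdDev_pos (hτ i) (x i) θ
    have h₂ := Real.sqrt_pos.2 (hw i)
    have h₃ := scoreFactor_pos γ (hτ i) (x i) θ
    have h₄ := hw i
    have hc : stdDev (τ i) (x i) θ / √(w i) * (w i * scoreFactor γ (τ i) (x i) θ) ≠ 0 := by
      positivity
    refine (mul_eq_zero.1 (?_ : stdDev (τ i) (x i) θ / √(w i) *
      (w i * scoreFactor γ (τ i) (x i) θ) * _ = 0)).resolve_left hc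
    rw [← h, dotProduct, Finset.mul_sum]
    exact Finset.sum_congr rfl fun j _ => by ring
  have hJy : matJ γ τ x w θ *ᵥ y = 0 := by
    rw [matJ_mulVec]
    simp [hdir]
  have := congrArg ((matJ γ τ x w θ)⁻¹ *ᵥ ·) hJy
  simpa [mulVec_mulVec, nonsing_inv_mul _ hJ] using this

/-- The matrix `B` for which `√K m(θ̂)` is asymptotically `B z`, where `z` is the vector of
standardized counts. -/
noncomputable def limitMatrix (m : Param J → Fin r → ℝ) (θ : Param J) : Matrix (Fin r) (Fin I) ℝ :=
  (gradMatrix m θ)ᵀ * (-(matJ γ τ x w θ)⁻¹ * rootK γ τ x w θ)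

lemma limitMatrix_mul_transpose (hτ : ∀ i, 0 < τ i) (hw : ∀ i, 0 < w i)
    (m : Param J → Fin r → ℝ) (θ : Param J) :
    limitMatrix γ τ x w m θ * (limitMatrix γ τ x w m θ)ᵀ =
      (gradMatrix m θ)ᵀ * sandwich γ τ x w θ * gradMatrix m θ := by
  simp only [limitMatrix, sandwich, transpose_mul, transpose_transpose, transpose_neg,
    ← rootK_mul_transpose γ τ x w hτ hw, transpose_nonsing_inv, matJ_transpose, Matrix.mul_assoc,
    Matrix.neg_mul, Matrix.mul_neg, neg_neg]

lemma mulVec_injective_of_rank_eq {m : ℕ} {n : Type*} [Fintype n] {A : Matrix n (Fin m) ℝ}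
    (h : A.rank = m) : Function.Injective A.mulVec := by
  rw [mulVec_injective_iff, linearIndependent_iff_card_eq_finrank_span, Fintype.card_fin,
    Set.finrank, ← rank_eq_finrank_span_cols, h]

/-- The transpose of `limitMatrix` is, up to sign, a composition of three injective maps:
`gradMatrix` by full rank, the inverse of `matJ`, and the transpose of `rootK`. -/
lemma posDef_limitMatrix (hτ : ∀ i, 0 < τ i) (hw : ∀ i, 0 < w i)
    (m : Param J → Fin r → ℝ) {θ : Param J} (hJ : IsUnit (matJ γ τ x w θ).det)
    (hrank : (gradMatrix m θ).rank = r) :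
    (limitMatrix γ τ x w m θ * (limitMatrix γ τ x w m θ)ᵀ).PosDef := by
  rw [← conjTranspose_eq_transpose_of_trivial]
  refine PosDef.mul_conjTranspose_self _ ?_
  intro u v huv
  have hJ' : IsUnit (matJ γ τ x w θ)⁻¹.det := by rwa [isUnit_nonsing_inv_det_iff]
  have e : ∀ u, u ᵥ* limitMatrix γ τ x w m θ =
      -((rootK γ τ x w θ)ᵀ *ᵥ ((matJ γ τ x w θ)⁻¹ *ᵥ (gradMatrix m θ *ᵥ u))) := fun u => by
    rw [← mulVec_transpose, limitMatrix]
    simp only [transpose_mul, transpose_transpose, transpose_neg, transpose_nonsing_inv,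
      matJ_transpose, mulVec_mulVec, Matrix.mul_neg, Matrix.neg_mul, neg_mulVec, Matrix.mul_assoc]
  simp only [e, neg_inj] at huv
  exact mulVec_injective_of_rank_eq hrank (mulVec_injective_iff_isUnit.2
    ((Matrix.isUnit_iff_isUnit_det _).2 hJ')
    (rootK_transpose_mulVec_injective γ τ x w hτ hw hJ huv))

/-! ### Limits of the matrices -/

variable {ι : Type*} {l : Filter ι}

lemma tendsto_matrix_inv {n : Type*} [Fintype n] [DecidableEq n] {A : ι → Matrix n n ℝ}
    {A₀ : Matrix n n ℝ} (h : Tendsto A l (𝓝 A₀)) (hA : IsUnit A₀.det) :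
    Tendsto (fun a => (A a)⁻¹) l (𝓝 A₀⁻¹) := by
  refine (continuousAt_matrix_inv A₀ ?_).tendsto.comp h
  simpa using! continuousAt_inv₀ hA.ne_zero

lemma continuous_blockM (hτ : ∀ i, 0 < τ i) (i : Fin I) : Continuous (blockM (τ i) (x i)) := by
  rw [show blockM (τ i) (x i) = _ from funext fun θ => blockM_eq (τ i) (x i) θ]
  exact (continuous_direction _ _ (hτ i)).matrix_vecMulVec (continuous_direction _ _ (hτ i))

variable {w} {w' : ι → Fin I → ℝ} {θ : ι → Param J} {θ₀ : Param J}

lemma tendsto_matJ (hτ : ∀ i, 0 < τ i) (hw' : Tendsto w' l (𝓝 w)) (hθ : Tendsto θ l (𝓝 θ₀)) :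
    Tendsto (fun a => matJ γ τ x (w' a) (θ a)) l (𝓝 (matJ γ τ x w θ₀)) := by
  refine tendsto_finsetSum _ fun i _ => ?_
  have hF := ((continuous_failProb (τ i) (x i) (hτ i)).tendsto θ₀).comp hθ
  have hR := ((continuous_relProb (τ i) (x i) (hτ i)).tendsto θ₀).comp hθ
  have hF' := hF.rpow_const (p := γ - 1) (Or.inl (failProb_pos (τ i) (x i) (hτ i) θ₀).ne')
  have hR' := hR.rpow_const (p := γ - 1) (Or.inl (relProb_pos (τ i) (x i) (hτ i) θ₀).ne')
  exact (((tendsto_pi_nhds.1 hw' i).mul ((hR.mul hF).pow 2)).mul (hF'.add hR')).smul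
    (((continuous_blockM τ x hτ i).tendsto θ₀).comp hθ)

lemma tendsto_matK (hτ : ∀ i, 0 < τ i) (hw' : Tendsto w' l (𝓝 w)) (hθ : Tendsto θ l (𝓝 θ₀)) :
    Tendsto (fun a => matK γ τ x (w' a) (θ a)) l (𝓝 (matK γ τ x w θ₀)) := by
  refine tendsto_finsetSum _ fun i _ => ?_
  have hF := ((continuous_failProb (τ i) (x i) (hτ i)).tendsto θ₀).comp hθ
  have hR := ((continuous_relProb (τ i) (x i) (hτ i)).tendsto θ₀).comp hθ
  have hF' := hF.rpow_const (p := γ - 1) (Or.inl (failProb_pos (τ i) (x i) (hτ i) θ₀).ne')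
  have hR' := hR.rpow_const (p := γ - 1) (Or.inl (relProb_pos (τ i) (x i) (hτ i) θ₀).ne')
  exact ((((tendsto_pi_nhds.1 hw' i).mul ((hF'.add hR').pow 2)).mul (hF.pow 3)).mul (hR.pow 3)).smul
    (((continuous_blockM τ x hτ i).tendsto θ₀).comp hθ)

lemma tendsto_covariance_inv (hτ : ∀ i, 0 < τ i) (hw : ∀ i, 0 < w i) (hw' : Tendsto w' l (𝓝 w))
    (hθ : Tendsto θ l (𝓝 θ₀)) (hJ : IsUnit (matJ γ τ x w θ₀).det) {m : Param J → Fin r → ℝ}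
    (hM : ContinuousAt (gradMatrix m) θ₀) (hrank : (gradMatrix m θ₀).rank = r) :
    Tendsto (fun a => ((gradMatrix m (θ a))ᵀ * sandwich γ τ x (w' a) (θ a) * gradMatrix m (θ a))⁻¹)
      l (𝓝 (limitMatrix γ τ x w m θ₀ * (limitMatrix γ τ x w m θ₀)ᵀ)⁻¹) := by
  have hdet := (posDef_limitMatrix γ τ x w hτ hw m hJ hrank).det_pos.ne'.isUnit
  rw [limitMatrix_mul_transpose γ τ x w hτ hw] at hdet ⊢
  have hM' := hM.tendsto.comp hθ
  have hJ' := tendsto_matrix_inv (tendsto_matJ γ τ x hτ hw' hθ) hJ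
  have hMt : Tendsto (fun a => (gradMatrix m (θ a))ᵀ) l (𝓝 (gradMatrix m θ₀)ᵀ) :=
    (continuous_id.matrix_transpose.tendsto _).comp hM'
  have hmul {a b c : Type} [Fintype a] [Fintype b] [Fintype c] {X : ι → Matrix a b ℝ}
      {Y : ι → Matrix b c ℝ} {X₀ : Matrix a b ℝ} {Y₀ : Matrix b c ℝ} (hX : Tendsto X l (𝓝 X₀))
      (hY : Tendsto Y l (𝓝 Y₀)) : Tendsto (fun i => X i * Y i) l (𝓝 (X₀ * Y₀)) :=
    ((continuous_fst.matrix_mul continuous_snd).tendsto (X₀, Y₀)).comp (hX.prodMk_nhds hY)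
  exact tendsto_matrix_inv
    (hmul (hmul hMt (hmul (hmul hJ' (tendsto_matK γ τ x hτ hw' hθ)) hJ')) hM') hdet

end Limit

/-! ### The estimator and the Wald-type statistic for bounded standardized counts -/

section Wald

open Asymptotics

variable {I J r : ℕ} (γ : ℝ) (τ : Fin I → ℝ) (x : Fin I → Fin (J + 1) → ℝ)

/-- The standardized numbers of failures. -/
noncomputable def standardizedCount (θ₀ : Param J) (K n : Fin I → ℕ) (i : Fin I) : ℝ :=
  (√(K i))⁻¹ * ((n i - K i * failProb (τ i) (x i) θ₀) / stdDev (τ i) (x i) θ₀)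

lemma frequency_sub_failProb (hτ : ∀ i, 0 < τ i) (θ₀ : Param J) {K : Fin I → ℕ} (n : Fin I → ℕ)
    (hK : 0 < total K) {i : Fin I} (hw : 0 < proportion K i) :
    (n i : ℝ) / K i - failProb (τ i) (x i) θ₀ =
      (√(total K))⁻¹ * (stdDev (τ i) (x i) θ₀ / √(proportion K i) *
        standardizedCount τ x θ₀ K n i) := by
  have hK₁ : (K i : ℝ) = proportion K i * total K := by
    rw [proportion, div_mul_cancel₀ _ hK.ne']
  have hK₀ : (0 : ℝ) < K i := by rw [hK₁]; positivity
  have hs := stdDev_pos (hτ i) (x i) θ₀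
  have hsq : √(K i : ℝ) = √(proportion K i) * √(total K) := by
    rw [← Real.sqrt_mul hw.le, ← hK₁]
  have h₁ := Real.sqrt_pos.2 hw
  have h₂ := Real.sqrt_pos.2 hK
  have h₃ := Real.sqrt_pos.2 hK₀
  have h₄ := Real.sq_sqrt hK₀.le
  rw [standardizedCount]
  calc (n i : ℝ) / K i - failProb (τ i) (x i) θ₀
      = (n i - K i * failProb (τ i) (x i) θ₀) / (√(K i : ℝ) * √(K i : ℝ)) := by
        rw [← sq, h₄]; field_simp
    _ = (n i - K i * failProb (τ i) (x i) θ₀) / (√(proportion K i) * √(total K) * √(K i : ℝ)) := by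
        rw [← hsq]
    _ = _ := by field_simp

variable {ι : Type*} {l : Filter ι} {θ₀ : Param J} {w : Fin I → ℝ} {K n : ι → Fin I → ℕ}

/-- The second part replaces the actual proportions by their limits, which is harmless because the
standardized counts stay bounded. -/
lemma frequency_isBigO (hτ : ∀ i, 0 < τ i) (hw : ∀ i, 0 < w i)
    (hK : Tendsto (fun a => total (K a)) l atTop)
    (hKw : Tendsto (fun a => proportion (K a)) l (𝓝 w)) {R : ℝ}
    (hz : ∀ᶠ a in l, ‖standardizedCount τ x θ₀ (K a) (n a)‖ ≤ R) :
    (∀ i, (fun a => (n a i : ℝ) / K a i - failProb (τ i) (x i) θ₀) =O[l]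
      fun a => (√(total (K a)))⁻¹) ∧
    ∀ i, (fun a => ((n a i : ℝ) / K a i - failProb (τ i) (x i) θ₀) - (√(total (K a)))⁻¹ *
      (stdDev (τ i) (x i) θ₀ / √(w i) * standardizedCount τ x θ₀ (K a) (n a) i)) =o[l]
        fun a => (√(total (K a)))⁻¹ := by
  rw [tendsto_pi_nhds] at hKw
  have hev : ∀ i, ∀ᶠ a in l, (n a i : ℝ) / K a i - failProb (τ i) (x i) θ₀ =
      (√(total (K a)))⁻¹ * (stdDev (τ i) (x i) θ₀ / √(proportion (K a) i) *
        standardizedCount τ x θ₀ (K a) (n a) i) := fun i => by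
    filter_upwards [hK.eventually_gt_atTop 0, (hKw i).eventually_const_lt (hw i)] with a h₁ h₂
    exact frequency_sub_failProb τ x hτ θ₀ (n a) h₁ h₂
  have hzO : ∀ i, (fun a => standardizedCount τ x θ₀ (K a) (n a) i) =O[l] fun _ => (1 : ℝ) :=
    fun i => IsBigO.of_bound R <| by
      filter_upwards [hz] with a ha
      simpa using (norm_le_pi_norm _ i).trans ha
  have hlim : ∀ i, Tendsto (fun a => stdDev (τ i) (x i) θ₀ / √(proportion (K a) i)) l
      (𝓝 (stdDev (τ i) (x i) θ₀ / √(w i))) := fun i =>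
    tendsto_const_nhds.div (hKw i).sqrt (Real.sqrt_pos.2 (hw i)).ne'
  refine ⟨fun i => ?_, fun i => ?_⟩
  · have := (isBigO_refl (fun a => (√(total (K a)))⁻¹) l).mul
      (((hlim i).isBigO_one ℝ).mul (hzO i))
    simp only [mul_one] at this
    exact this.congr' ((hev i).mono fun a ha => ha.symm) EventuallyEq.rfl
  · have h₁ : (fun a => stdDev (τ i) (x i) θ₀ / √(proportion (K a) i) -
        stdDev (τ i) (x i) θ₀ / √(w i)) =o[l] fun _ => (1 : ℝ) := by
      rw [isLittleO_one_iff, ← sub_self (stdDev (τ i) (x i) θ₀ / √(w i))]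
      exact (hlim i).sub_const _
    have := (isBigO_refl (fun a => (√(total (K a)))⁻¹) l).mul_isLittleO (h₁.mul_isBigO (hzO i))
    simp only [mul_one] at this
    refine this.congr' ?_ EventuallyEq.rfl
    filter_upwards [hev i] with a ha
    rw [ha]
    ring

lemma tendsto_inv_sqrt_total (hK : Tendsto (fun a => total (K a)) l atTop) :
    Tendsto (fun a => (√(total (K a)))⁻¹) l (𝓝 0) :=
  tendsto_inv_atTop_zero.comp (Real.tendsto_sqrt_atTop.comp hK)

lemma estimator_expansion (hγ : 0 ≤ γ) (hτ : ∀ i, 0 < τ i) {Θ : Set (Param J)}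
    {est : (Fin I → ℕ) → (Fin I → ℕ) → Param J} (hest : IsWMDPDE γ τ x Θ est)
    (hθ₀ : θ₀ ∈ interior Θ)
    (hident : ∀ ε > 0, ∃ δ > 0, ∀ θ ∈ Θ, ε ≤ dist θ θ₀ →
      ∃ i, δ ≤ |failProb (τ i) (x i) θ - failProb (τ i) (x i) θ₀|)
    (hJ : IsUnit (matJ γ τ x w θ₀).det) (hw : ∀ i, 0 < w i)
    (hK : Tendsto (fun a => total (K a)) l atTop)
    (hKw : Tendsto (fun a => proportion (K a)) l (𝓝 w)) (hn : ∀ᶠ a in l, ∀ i, n a i ≤ K a i)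
    {R : ℝ} (hz : ∀ᶠ a in l, ‖standardizedCount τ x θ₀ (K a) (n a)‖ ≤ R) :
    Tendsto (fun a => est (K a) (n a)) l (𝓝 θ₀) ∧
    (fun a => est (K a) (n a) - θ₀) =O[l] (fun a => (√(total (K a)))⁻¹) ∧
    (fun a => est (K a) (n a) - θ₀ - (√(total (K a)))⁻¹ •
      ((-(matJ γ τ x w θ₀)⁻¹ * rootK γ τ x w θ₀) *ᵥ standardizedCount τ x θ₀ (K a) (n a))) =o[l]
        (fun a => (√(total (K a)))⁻¹) := by
  obtain ⟨hO, ho⟩ := frequency_isBigO τ x hτ hw hK hKw hz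
  have hp : Tendsto (fun a i => (n a i : ℝ) / K a i) l (𝓝 fun i => failProb (τ i) (x i) θ₀) :=
    tendsto_pi_nhds.2 fun i =>
      tendsto_sub_nhds_zero_iff.1 ((hO i).trans_tendsto (tendsto_inv_sqrt_total hK))
  have hmin : ∀ᶠ a in l, est (K a) (n a) ∈ Θ ∧
      IsMinOn (objective γ τ x (proportion (K a)) fun i => (n a i : ℝ) / K a i) Θ
        (est (K a) (n a)) := by
    -- Since a minimizer eventually exists, the arbitrary values of the estimator elsewhere play no
    -- role.
    filter_upwards [eventually_exists_isMinOn γ τ x hγ hτ hθ₀ hident hw hKw hp, hn] with a ha hna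
    simp only [← weightedDPD_eq_objective γ τ hτ x] at ha ⊢
    exact hest _ _ hna ha
  have hlim := tendsto_of_isMinOn γ τ x hγ hτ hθ₀ hident hw hKw hp hmin
  have heq : ∀ᶠ a in l, ∑ i, (failProb (τ i) (x i) (est (K a) (n a)) - (n a i : ℝ) / K a i) •
      scoreVec γ τ x (proportion (K a)) (est (K a) (n a)) i = 0 := by
    -- Consistency puts the estimate in the interior of `Θ`, where the first-order condition holds.
    filter_upwards [hmin, hlim.eventually (isOpen_interior.mem_nhds hθ₀),
      eventually_mem_Ioo_of_tendsto τ x hτ hp] with a h₁ h₂ ⟨hp₀, hp₁⟩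
    simpa only [scoreVec, smul_smul] using estimating_equation γ τ x hγ hτ hp₀ hp₁ h₂ h₁.2
  obtain ⟨h₁, h₂⟩ := linearization γ τ x hτ hJ hKw hlim hO heq
  refine ⟨hlim, h₁, ?_⟩
  have h₃ : (fun a => ∑ i, (((n a i : ℝ) / K a i - failProb (τ i) (x i) θ₀) -
      (√(total (K a)))⁻¹ * (stdDev (τ i) (x i) θ₀ / √(w i) *
        standardizedCount τ x θ₀ (K a) (n a) i)) • scoreVec γ τ x w θ₀ i) =o[l]
          fun a => (√(total (K a)))⁻¹ := by
    refine IsLittleO.fun_sum fun i _ => IsBigO.trans_isLittleO (IsBigO.of_bound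
      ‖scoreVec γ τ x w θ₀ i‖ (Eventually.of_forall fun a => ?_)) (ho i)
    exact (norm_smul_le _ (scoreVec γ τ x w θ₀ i)).trans_eq (mul_comm _ _)
  have h₄ := ((LinearMap.toContinuousLinearMap
    (Matrix.mulVecLin (matJ γ τ x w θ₀)⁻¹)).isBigO_comp _ l).trans_isLittleO h₃
  refine (h₂.sub h₄).congr_left fun a => ?_
  simp only [LinearMap.coe_toContinuousLinearMap', mulVecLin_apply, sub_smul,
    Finset.sum_sub_distrib, mulVec_sub, ← mulVec_mulVec, rootK_mulVec,
    mul_smul _ _ (scoreVec _ _ _ _ _ _), neg_mulVec, ← Finset.smul_sum, mulVec_smul, smul_neg]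
  abel

lemma fderiv_apply_eq_gradMatrix (m : Param J → Fin r → ℝ) (θ h : Param J) :
    fderiv ℝ m θ h = (gradMatrix m θ)ᵀ *ᵥ h := by
  conv_lhs => rw [pi_eq_sum_univ' h]
  ext k
  simp only [map_sum, map_smul, Finset.sum_apply, Pi.smul_apply, smul_eq_mul, mulVec, dotProduct,
    transpose_apply, gradMatrix, of_apply]
  exact Finset.sum_congr rfl fun j _ => mul_comm _ _

lemma restriction_expansion {m : Param J → Fin r → ℝ} (hm : DifferentiableAt ℝ m θ₀)
    (hm₀ : m θ₀ = 0) {θ v : ι → Param J} {t : ι → ℝ} (hθ : Tendsto θ l (𝓝 θ₀))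
    (hO : (fun a => θ a - θ₀) =O[l] t) (ho : (fun a => θ a - θ₀ - t a • v a) =o[l] t) :
    (fun a => m (θ a) - t a • ((gradMatrix m θ₀)ᵀ *ᵥ v a)) =o[l] t := by
  have h₁ := (hm.hasFDerivAt.isLittleO.comp_tendsto hθ).trans_isBigO hO
  have h₂ := ((fderiv ℝ m θ₀).isBigO_comp _ l).trans_isLittleO ho
  refine (h₁.add h₂).congr_left fun a => ?_
  simp only [Function.comp, hm₀, map_sub, map_smul, fderiv_apply_eq_gradMatrix]
  abel

/-- The vectors `v a` are only bounded and need not converge, so continuity of the quadratic form is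
used uniformly near the compact set `{Q₀} × closedBall 0 R`. -/
lemma tendsto_quadratic_sub {Q : ι → Matrix (Fin r) (Fin r) ℝ} {Q₀ : Matrix (Fin r) (Fin r) ℝ}
    (hQ : Tendsto Q l (𝓝 Q₀)) {u v : ι → Fin r → ℝ} {R : ℝ} (hv : ∀ᶠ a in l, ‖v a‖ ≤ R)
    (huv : Tendsto (fun a => u a - v a) l (𝓝 0)) :
    Tendsto (fun a => u a ⬝ᵥ (Q a *ᵥ u a) - v a ⬝ᵥ (Q₀ *ᵥ v a)) l (𝓝 0) := by
  let f : Matrix (Fin r) (Fin r) ℝ × (Fin r → ℝ) → ℝ := fun y => y.2 ⬝ᵥ (y.1 *ᵥ y.2)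
  have hf : Continuous f := by fun_prop
  have hpair : Tendsto (fun a => ((Q₀, v a), (Q a, u a))) l
      (uniformity (Matrix (Fin r) (Fin r) ℝ × (Fin r → ℝ))) := by
    rw [uniformity_prod, tendsto_inf, tendsto_comap_iff, tendsto_comap_iff]
    refine ⟨Uniform.tendsto_nhds_right.1 hQ, ?_⟩
    rw [uniformity_eq_comap_nhds_zero, tendsto_comap_iff]
    exact huv
  rw [Metric.tendsto_nhds]
  intro ε hε
  have hcomp : IsCompact
      (({Q₀} : Set (Matrix (Fin r) (Fin r) ℝ)) ×ˢ Metric.closedBall (0 : Fin r → ℝ) R) :=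
    isCompact_singleton.prod (isCompact_closedBall 0 R)
  filter_upwards [hpair (hcomp.uniformContinuousAt_of_continuousAt f
    (fun _ _ => hf.continuousAt) (Metric.dist_mem_uniformity hε)), hv] with a ha hva
  have := ha ⟨rfl, by simpa using hva⟩
  rw [Real.dist_eq, sub_zero]
  rw [dist_comm, Real.dist_eq] at this
  exact this

variable {γ τ x}

/-- The quadratic form which is the limit of the Wald-type statistic under the null hypothesis. -/
noncomputable def limitForm {q : ℕ} (B : Matrix (Fin r) (Fin q) ℝ) (z : Fin q → ℝ) : ℝ :=
  (B *ᵥ z) ⬝ᵥ ((B * Bᵀ)⁻¹ *ᵥ (B *ᵥ z))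

lemma continuous_limitForm {q : ℕ} (B : Matrix (Fin r) (Fin q) ℝ) : Continuous (limitForm B) := by
  unfold limitForm
  fun_prop

theorem waldStat_sub_limitForm (hγ : 0 ≤ γ) (hτ : ∀ i, 0 < τ i) {Θ : Set (Param J)}
    {est : (Fin I → ℕ) → (Fin I → ℕ) → Param J} (hest : IsWMDPDE γ τ x Θ est)
    (hθ₀ : θ₀ ∈ interior Θ)
    (hident : ∀ ε > 0, ∃ δ > 0, ∀ θ ∈ Θ, ε ≤ dist θ θ₀ →
      ∃ i, δ ≤ |failProb (τ i) (x i) θ - failProb (τ i) (x i) θ₀|)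
    (hJ : IsUnit (matJ γ τ x w θ₀).det) (hw : ∀ i, 0 < w i)
    {m : Param J → Fin r → ℝ} (hm : DifferentiableAt ℝ m θ₀)
    (hM : ContinuousAt (gradMatrix m) θ₀) (hrank : (gradMatrix m θ₀).rank = r) (hm₀ : m θ₀ = 0)
    (hK : Tendsto (fun a => total (K a)) l atTop)
    (hKw : Tendsto (fun a => proportion (K a)) l (𝓝 w)) (hn : ∀ᶠ a in l, ∀ i, n a i ≤ K a i)
    {R : ℝ} (hz : ∀ᶠ a in l, ‖standardizedCount τ x θ₀ (K a) (n a)‖ ≤ R) :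
    Tendsto (fun a => waldStat γ τ x m (K a) (est (K a) (n a)) -
      limitForm (limitMatrix γ τ x w m θ₀) (standardizedCount τ x θ₀ (K a) (n a))) l (𝓝 0) := by
  obtain ⟨hlim, hO, ho⟩ := estimator_expansion γ τ x hγ hτ hest hθ₀ hident hJ hw hK hKw hn hz
  have hexp := restriction_expansion hm hm₀ hlim hO ho
  have hQ := tendsto_covariance_inv γ τ x hτ hw hKw hlim hJ hM hrank
  set B := limitMatrix γ τ x w m θ₀ with hB
  set z := fun a => standardizedCount τ x θ₀ (K a) (n a) with hzdef
  have hpos := hK.eventually_gt_atTop 0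
  have hdiff : Tendsto (fun a => √(total (K a)) • m (est (K a) (n a)) - B *ᵥ z a) l (𝓝 0) := by
    have h₁ := ((isBigO_refl (fun a => √(total (K a))) l).smul_isLittleO hexp)
    have h₂ : (fun a => √(total (K a)) • (√(total (K a)))⁻¹) =O[l] fun _ => (1 : ℝ) :=
      IsBigO.of_bound 1 (hpos.mono fun a ha => by
        rw [smul_eq_mul, mul_inv_cancel₀ (Real.sqrt_pos.2 ha).ne', one_mul])
    refine ((isLittleO_one_iff ℝ).1 (h₁.trans_isBigO h₂)).congr' ?_
    filter_upwards [hpos] with a ha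
    rw [smul_sub, smul_smul, mul_inv_cancel₀ (Real.sqrt_pos.2 ha).ne', one_smul, mulVec_mulVec, hB,
      limitMatrix]
  have hbdd : ∃ C, ∀ᶠ a in l, ‖B *ᵥ z a‖ ≤ C := by
    refine ⟨‖LinearMap.toContinuousLinearMap (Matrix.mulVecLin B)‖ * R, ?_⟩
    filter_upwards [hz] with a ha
    exact (ContinuousLinearMap.le_opNorm (LinearMap.toContinuousLinearMap (Matrix.mulVecLin B))
      (z a)).trans (mul_le_mul_of_nonneg_left ha (norm_nonneg _))
  obtain ⟨C, hC⟩ := hbdd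
  refine (tendsto_quadratic_sub hQ hC hdiff).congr' ?_
  filter_upwards [hpos] with a ha
  rw [limitForm, waldStat, mulVec_smul, smul_dotProduct, dotProduct_smul, smul_smul,
    Real.mul_self_sqrt ha.le, smul_eq_mul]

theorem waldStat_tendsto_atTop (hγ : 0 ≤ γ) (hτ : ∀ i, 0 < τ i) {Θ : Set (Param J)}
    {est : (Fin I → ℕ) → (Fin I → ℕ) → Param J} (hest : IsWMDPDE γ τ x Θ est)
    (hθ₀ : θ₀ ∈ interior Θ)
    (hident : ∀ ε > 0, ∃ δ > 0, ∀ θ ∈ Θ, ε ≤ dist θ θ₀ →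
      ∃ i, δ ≤ |failProb (τ i) (x i) θ - failProb (τ i) (x i) θ₀|)
    (hJ : IsUnit (matJ γ τ x w θ₀).det) (hw : ∀ i, 0 < w i)
    {m : Param J → Fin r → ℝ} (hm : DifferentiableAt ℝ m θ₀)
    (hM : ContinuousAt (gradMatrix m) θ₀) (hrank : (gradMatrix m θ₀).rank = r) (hm₀ : m θ₀ ≠ 0)
    (hK : Tendsto (fun a => total (K a)) l atTop)
    (hKw : Tendsto (fun a => proportion (K a)) l (𝓝 w)) (hn : ∀ᶠ a in l, ∀ i, n a i ≤ K a i)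
    {R : ℝ} (hz : ∀ᶠ a in l, ‖standardizedCount τ x θ₀ (K a) (n a)‖ ≤ R) :
    Tendsto (fun a => waldStat γ τ x m (K a) (est (K a) (n a))) l atTop := by
  obtain ⟨hlim, -, -⟩ := estimator_expansion γ τ x hγ hτ hest hθ₀ hident hJ hw hK hKw hn hz
  have hQ := tendsto_covariance_inv γ τ x hτ hw hKw hlim hJ hM hrank
  have hmlim := hm.continuousAt.tendsto.comp hlim
  have hf : Continuous fun y : Matrix (Fin r) (Fin r) ℝ × (Fin r → ℝ) =>
    y.2 ⬝ᵥ (y.1 *ᵥ y.2) := by fun_prop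
  have hpos := (posDef_limitMatrix γ τ x w hτ hw m hJ hrank).inv.dotProduct_mulVec_pos hm₀
  rw [star_trivial] at hpos
  exact hK.atTop_mul_pos hpos ((hf.tendsto _).comp (hQ.prodMk_nhds hmlim))

end Wald

/-! ### Weak convergence -/

section Weak

variable {Ω : Type*} [MeasurableSpace Ω] {P : Measure Ω}

/-- The joint law of the array is a product over pairs; currying it gives a product over rows. It is
needed because the counts of different conditions depend on different rows of lifetimes. -/
lemma iIndepFun_rows {α κ 𝓧 : Type*} [MeasurableSpace 𝓧] [IsProbabilityMeasure P]
    {X : α → κ → Ω → 𝓧} (mX : ∀ i k, Measurable (X i k))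
    (h : iIndepFun (fun p : α × κ => X p.1 p.2) P) :
    iIndepFun (fun i ω k => X i k ω) P := by
  have hprob : ∀ i k, IsProbabilityMeasure (P.map (X i k)) := fun i k =>
    Measure.isProbabilityMeasure_map (mX i k).aemeasurable
  have hrow (i : α) : P.map (fun ω k => X i k ω) = Measure.infinitePi fun k => P.map (X i k) :=
    (h.precomp (g := fun k => (i, k)) fun _ _ hk => (Prod.ext_iff.1 hk).2).map_fun_eq_infinitePi_map
      fun k => mX i k
  rw [iIndepFun_iff_map_fun_eq_infinitePi_map fun i => measurable_pi_lambda _ fun k => mX i k]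
  simp only [hrow]
  have hjoint := h.map_fun_eq_infinitePi_map fun p : α × κ => mX p.1 p.2
  rw [← Measure.infinitePi_map_curry fun i k => P.map (X i k), ← hjoint,
    Measure.map_map (by fun_prop) (measurable_pi_lambda _ fun p : α × κ => mX p.1 p.2)]
  rfl

lemma tendstoInDistribution_pi {ι : Type*} {l : Filter ι} {q : ℕ} [IsProbabilityMeasure P]
    {X : ι → Fin q → Ω → ℝ} {ν : Fin q → Measure ℝ} [∀ i, IsProbabilityMeasure (ν i)]
    (hX : ∀ i, TendstoInDistribution (fun a => X a i) l (fun y : ℝ => y) (fun _ => P) (ν i))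
    (hind : ∀ a, iIndepFun (X a) P) :
    TendstoInDistribution (fun a ω i => X a i ω) l (fun z : Fin q → ℝ => z) (fun _ => P)
      (Measure.pi ν) where
  forall_aemeasurable a := aemeasurable_pi_iff.2 fun i => (hX i).forall_aemeasurable a
  aemeasurable_limit := aemeasurable_id'
  tendsto := by
    have h := (ProbabilityMeasure.continuous_pi (α := fun _ : Fin q => ℝ)).continuousAt.tendsto.comp
      (tendsto_pi_nhds.2 fun i => (hX i).tendsto)
    refine (h.congr fun a => ?_).trans_eq (congrArg 𝓝 ?_)
    · exact Subtype.ext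
        ((hind a).map_fun_eq_pi_map fun i => (hX i).forall_aemeasurable a).symm
    · exact Subtype.ext (by simp [ProbabilityMeasure.pi, Measure.map_id'])

variable {E : Type*} [NormedAddCommGroup E] [MeasurableSpace E] [BorelSpace E]

/-- Tightness: the limit law gives small mass to some closed set `{k ≤ ‖z‖}`, and the portmanteau
inequality for closed sets transfers this to `Z a`. -/
lemma eventually_measure_norm_lt {ι : Type*} {l : Filter ι} [IsProbabilityMeasure P]
    {μ : Measure E} [IsProbabilityMeasure μ] {Z : ι → Ω → E}
    (hZ : TendstoInDistribution Z l (fun z : E => z) (fun _ => P) μ) {η : ENNReal} (hη : 0 < η) :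
    ∃ R : ℝ, ∀ᶠ a in l, P {ω | R < ‖Z a ω‖} < η := by
  have hlim : Tendsto (fun k : ℕ => μ {z : E | (k : ℝ) ≤ ‖z‖}) atTop (𝓝 0) := by
    have := tendsto_measure_iInter_atTop (μ := μ) (s := fun k : ℕ => {z : E | (k : ℝ) ≤ ‖z‖})
      (fun k => (isClosed_le continuous_const continuous_norm).measurableSet.nullMeasurableSet)
      (fun i j hij z (hz : (j : ℝ) ≤ ‖z‖) =>
        show (i : ℝ) ≤ ‖z‖ from (Nat.cast_le.2 hij).trans hz) ⟨0, measure_ne_top _ _⟩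
    rwa [show ⋂ k : ℕ, {z : E | (k : ℝ) ≤ ‖z‖} = ∅ by
      ext z
      obtain ⟨k, hk⟩ := exists_nat_gt ‖z‖
      simp only [Set.mem_iInter, Set.mem_ofPred_eq, Set.mem_empty_iff_false, iff_false, not_forall]
      exact ⟨k, hk.not_ge⟩, measure_empty] at this
  obtain ⟨k, hk⟩ := (hlim.eventually_lt_const hη).exists
  refine ⟨k, ?_⟩
  have hcl : IsClosed {z : E | (k : ℝ) ≤ ‖z‖} := isClosed_le continuous_const continuous_norm
  have hsup := ProbabilityMeasure.limsup_measure_closed_le_of_tendsto hZ.tendsto hcl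
  simp only [ProbabilityMeasure.coe_mk, Measure.map_id'] at hsup
  filter_upwards [eventually_lt_of_limsup_lt (hsup.trans_lt hk)] with a ha
  rw [Measure.map_apply_of_aemeasurable (hZ.forall_aemeasurable a) hcl.measurableSet] at ha
  exact (measure_mono fun ω (hω : (k : ℝ) < ‖Z a ω‖) => hω.le).trans_lt ha

/-- A form of Slutsky's theorem: by tightness, approximation that is uniform on each event `‖Z N‖ ≤
R` implies approximation in probability. -/
lemma tendstoInDistribution_of_bounded_approx [IsProbabilityMeasure P] {μ : Measure E}
    [IsProbabilityMeasure μ] {Z : ℕ → Ω → E}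
    (hZ : TendstoInDistribution Z atTop (fun z : E => z) (fun _ => P) μ) {g : E → ℝ}
    (hg : Continuous g) {W : ℕ → Ω → ℝ} (hW : ∀ N, AEMeasurable (W N) P)
    (happrox : ∀ R, ∀ ε > 0, ∀ᶠ N in atTop, ∀ ω, ‖Z N ω‖ ≤ R → |W N ω - g (Z N ω)| < ε) :
    TendstoInDistribution W atTop g (fun _ => P) μ := by
  refine tendstoInDistribution_of_tendstoInMeasure_sub W g (hZ.continuous_comp hg) ?_ hW
  rw [tendstoInMeasure_iff_norm]
  intro ε hε
  rw [ENNReal.tendsto_nhds_zero]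
  intro η hη
  obtain ⟨R, hR⟩ := eventually_measure_norm_lt hZ hη
  filter_upwards [hR, happrox R ε hε] with N h₁ h₂
  refine (measure_mono fun ω hω => ?_).trans h₁.le
  by_contra h
  have := h₂ ω (not_lt.1 h)
  simp only [Set.mem_ofPred_eq, Pi.sub_apply, Pi.zero_apply, sub_zero, Function.comp,
    Real.norm_eq_abs] at hω
  linarith

lemma tendsto_one_of_bounded [IsProbabilityMeasure P] {μ : Measure E}
    [IsProbabilityMeasure μ] {Z : ℕ → Ω → E}
    (hZ : TendstoInDistribution Z atTop (fun z : E => z) (fun _ => P) μ) {A : ℕ → Set Ω}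
    (hA : ∀ R, ∀ᶠ N in atTop, ∀ ω, ‖Z N ω‖ ≤ R → ω ∈ A N) :
    Tendsto (fun N => P.real (A N)) atTop (𝓝 1) := by
  rw [Metric.tendsto_nhds]
  intro ε hε
  obtain ⟨R, hR⟩ := eventually_measure_norm_lt hZ (ENNReal.ofReal_pos.2 hε)
  filter_upwards [hR, hA R] with N h₁ h₂
  have h₃ : P.real {ω | R < ‖Z N ω‖} < ε :=
    (ENNReal.lt_ofReal_iff_toReal_lt (measure_ne_top _ _)).1 h₁
  have h₄ : 1 ≤ P.real (A N) + P.real {ω | R < ‖Z N ω‖} := by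
    rw [← probReal_univ (μ := P)]
    refine (measureReal_mono fun ω _ => ?_).trans (measureReal_union_le _ _)
    rcases le_or_gt ‖Z N ω‖ R with h | h
    · exact Or.inl (h₂ ω h)
    · exact Or.inr h
  have h₅ : P.real (A N) ≤ 1 := measureReal_le_one
  rw [Real.dist_eq, abs_lt]
  constructor <;> linarith

end Weak

/-! ### The chi-square law -/

section ChiSquare

/-- The characteristic function of the image at `t` is the Gaussian one at `Cᵀ t`, and `C Cᵀ = 1`
makes `Cᵀ` an isometry. -/
lemma map_mulVec_stdGaussian {q r : ℕ} {C : Matrix (Fin r) (Fin q) ℝ} (hC : C * Cᵀ = 1) :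
    (Measure.pi fun _ : Fin q => gaussianReal 0 1).map (C *ᵥ ·) =
      Measure.pi fun _ : Fin r => gaussianReal 0 1 := by
  refine (MeasurableEquiv.toLp 2 (Fin r → ℝ)).map_measurableEquiv_injective ?_
  rw [MeasurableEquiv.coe_toLp, map_pi_eq_stdGaussian]
  have hmeas : Measurable fun z : Fin q → ℝ => C *ᵥ z :=
    (Continuous.matrix_mulVec continuous_const continuous_id).measurable
  rw [Measure.map_map (by fun_prop) hmeas]
  refine Measure.ext_of_charFun (E := EuclideanSpace ℝ (Fin r)) (funext fun t => ?_)
  have hadj : charFun ((Measure.pi fun _ : Fin q => gaussianReal 0 1).map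
      (WithLp.toLp 2 ∘ fun z => C *ᵥ z)) t =
        charFun (stdGaussian (EuclideanSpace ℝ (Fin q))) (WithLp.toLp 2 (Cᵀ *ᵥ t.ofLp)) := by
    rw [← map_pi_eq_stdGaussian, charFun_apply, charFun_apply,
      integral_map ((WithLp.measurable_toLp 2 _).comp hmeas).aemeasurable (by fun_prop),
      integral_map (by fun_prop) (by fun_prop)]
    refine integral_congr_ae (Eventually.of_forall fun z => ?_)
    simp only [Function.comp, EuclideanSpace.inner_eq_star_dotProduct, star_trivial]
    rw [dotProduct_mulVec, mulVec_transpose]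
  rw [hadj, charFun_stdGaussian, charFun_stdGaussian]
  have hnorm : ‖(WithLp.toLp 2 (Cᵀ *ᵥ t.ofLp) : EuclideanSpace ℝ (Fin q))‖ ^ 2 = ‖t‖ ^ 2 := by
    rw [← real_inner_self_eq_norm_sq, ← real_inner_self_eq_norm_sq]
    simp only [EuclideanSpace.inner_eq_star_dotProduct, star_trivial]
    rw [dotProduct_mulVec, vecMul_transpose, mulVec_mulVec, hC, one_mulVec]
  rw [← Complex.ofReal_pow, hnorm, Complex.ofReal_pow]

open scoped MatrixOrder in
lemma exists_orthogonalization {q r : ℕ} {B : Matrix (Fin r) (Fin q) ℝ} (hB : (B * Bᵀ).PosDef) :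
    ∃ C : Matrix (Fin r) (Fin q) ℝ, C * Cᵀ = 1 ∧ ∀ z, limitForm B z = ∑ k, (C *ᵥ z) k ^ 2 := by
  set V := B * Bᵀ with hV
  set S := CFC.sqrt V⁻¹ with hS
  have hSS : S * S = V⁻¹ := CFC.sqrt_mul_sqrt_self _ hB.inv.posSemidef.nonneg
  have hSt : Sᵀ = S := by
    have h := (CFC.sqrt_nonneg V⁻¹).posSemidef.isHermitian
    rwa [IsHermitian, conjTranspose_eq_transpose_of_trivial] at h
  have hVdet : IsUnit V.det := hB.det_pos.ne'.isUnit
  -- The witness is `V^{-1/2} B`, which normalizes the rows of `B`.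
  refine ⟨S * B, ?_, fun z => ?_⟩
  · have h₁ : S * (S * V) = 1 := by
      rw [← Matrix.mul_assoc, hSS, nonsing_inv_mul _ hVdet]
    calc S * B * (S * B)ᵀ = S * V * S := by
          rw [transpose_mul, hSt, hV]; simp only [Matrix.mul_assoc]
      _ = 1 := mul_eq_one_comm.1 h₁
  · have h₂ : ∑ k, ((S * B) *ᵥ z) k ^ 2 = ((S * B) *ᵥ z) ⬝ᵥ ((S * B) *ᵥ z) := by
      simp [dotProduct, sq]
    rw [h₂, limitForm, ← hV, ← hSS, ← mulVec_mulVec, ← mulVec_mulVec z S B,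
      dotProduct_mulVec, ← mulVec_transpose, hSt]

lemma map_limitForm {q r : ℕ} {B : Matrix (Fin r) (Fin q) ℝ} (hB : (B * Bᵀ).PosDef) :
    (Measure.pi fun _ : Fin q => gaussianReal 0 1).map (limitForm B) = chiSquare r := by
  obtain ⟨C, hC, hCB⟩ := exists_orthogonalization hB
  have hmeas : Measurable fun z : Fin q → ℝ => C *ᵥ z :=
    (Continuous.matrix_mulVec continuous_const continuous_id).measurable
  rw [chiSquare, ← map_mulVec_stdGaussian hC, Measure.map_map (by fun_prop) hmeas]
  exact congrArg (fun f => Measure.map f _) (funext hCB)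

/-- With all coordinates but one fixed, the remaining one must be one of at most two square roots, a
null set for the Gaussian law; Fubini concludes. For `r = 0` the law is a point mass. -/
lemma nullSingletonClass_chiSquare {r : ℕ} (hr : 0 < r) : NullSingletonClass (chiSquare r) := by
  obtain ⟨k, rfl⟩ : ∃ k, r = k + 1 := ⟨r - 1, by omega⟩
  refine ⟨fun c => ?_⟩
  have hmeas : Measurable fun z : Fin (k + 1) → ℝ => ∑ k, z k ^ 2 := by fun_prop
  rw [chiSquare, Measure.map_apply hmeas (measurableSet_singleton c)]
  have hmp := (measurePreserving_piFinSuccAbove (fun _ : Fin (k + 1) => gaussianReal 0 1) 0).symm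
  rw [← hmp.measure_preimage (hmeas (measurableSet_singleton c)).nullMeasurableSet,
    Measure.prod_apply_symm (hmp.measurable (hmeas (measurableSet_singleton c)))]
  have := nullSingletonClass_gaussianReal (μ := 0) one_ne_zero
  refine (lintegral_congr fun y => ?_).trans lintegral_zero
  refine measure_mono_null (fun u hu => ?_)
    (Set.Finite.measure_zero (s := {√(c - ∑ j, y j ^ 2), -√(c - ∑ j, y j ^ 2)})
      (Set.toFinite _) (gaussianReal 0 1))
  have hu' : u ^ 2 + ∑ j, y j ^ 2 = c := by
    simpa [MeasurableEquiv.piFinSuccAbove, Fin.sum_univ_succ] using hu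
  rw [← hu', add_sub_cancel_right, Real.sqrt_sq_eq_abs]
  rcases abs_choice u with h | h <;> simp [h]

lemma continuous_cdf (μ : Measure ℝ) [IsProbabilityMeasure μ] [NullSingletonClass μ] :
    Continuous (cdf μ) := by
  refine continuous_iff_continuousAt.2 fun c => ?_
  have h := (cdf μ).measure_singleton c
  rw [measure_cdf, measure_singleton, eq_comm, ENNReal.ofReal_eq_zero] at h
  rw [(monotone_cdf μ).continuousAt_iff_leftLim_eq_rightLim, (cdf μ).rightLim_eq]
  exact le_antisymm ((monotone_cdf μ).leftLim_le le_rfl) (by linarith)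

lemma chiSquare_Ioi_quantile {r : ℕ} (hr : 0 < r) {α : ℝ} (hα₀ : 0 < α) (hα₁ : α < 1) :
    (chiSquare r).real (Set.Ioi (chiSquareQuantile r α)) = α := by
  have := nullSingletonClass_chiSquare hr
  set μ := chiSquare r with hμ
  have htail : ∀ c, μ.real (Set.Ioi c) = 1 - cdf μ c := fun c => by
    rw [cdf_eq_real, ← probReal_compl_eq_one_sub measurableSet_Iic, Set.compl_Iic]
  set A : Set ℝ := {c | μ.real (Set.Ioi c) ≤ α} with hA
  have hcont : Continuous fun c => μ.real (Set.Ioi c) := by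
    simp only [htail]
    exact continuous_const.sub (continuous_cdf μ)
  have hne : A.Nonempty := by
    obtain ⟨c, hc⟩ := ((tendsto_cdf_atTop μ).eventually_const_lt
      (show 1 - α < 1 by linarith)).exists
    refine ⟨c, ?_⟩
    rw [hA, Set.mem_ofPred_eq, htail]
    linarith
  have hbdd : BddBelow A := by
    obtain ⟨c, hc⟩ := ((tendsto_cdf_atBot μ).eventually_lt_const
      (show 0 < 1 - α by linarith)).exists
    refine ⟨c, fun d hd => ?_⟩
    by_contra! h
    rw [hA, Set.mem_ofPred_eq, htail] at hd
    linarith [monotone_cdf μ h.le]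
  have hmem : sInf A ∈ A := (isClosed_le hcont continuous_const).csInf_mem hne hbdd
  refine le_antisymm hmem (le_of_not_gt fun hlt => ?_)
  -- If the tail at the infimum were strictly below `α`, continuity would give a smaller element of
  -- `A`.
  obtain ⟨c, hc, hcα⟩ := (((hcont.tendsto (sInf A)).eventually_lt_const hlt).filter_mono
    (nhdsWithin_le_nhds (s := Set.Iio (sInf A))) |>.and self_mem_nhdsWithin).exists
  exact (csInf_le hbdd (show c ∈ A from hc.le)).not_gt hcα

end ChiSquare

/-! ### The limit law of the standardized counts -/

section Counts

variable {I J : ℕ} {Ω : Type*}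

/-- The standardized failure indicator of a device with lifetime `t` under condition `i`. -/
noncomputable def standardizedFailure (τ : ℝ) (x : Fin (J + 1) → ℝ) (θ₀ : Param J) (t : ℝ) : ℝ :=
  ((Set.Iic τ).indicator (fun _ => 1) t - failProb τ x θ₀) / stdDev τ x θ₀

lemma standardizedCount_failures (τ : Fin I → ℝ) (x : Fin I → Fin (J + 1) → ℝ) (θ₀ : Param J)
    (T : Fin I → ℕ → Ω → ℝ) (K : Fin I → ℕ) (ω : Ω) (i : Fin I) :
    standardizedCount τ x θ₀ K (failures τ T K ω) i =
      (√(K i))⁻¹ * ∑ k ∈ Finset.range (K i), standardizedFailure (τ i) (x i) θ₀ (T i k ω) := by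
  simp only [standardizedCount, standardizedFailure, ← Finset.sum_div, Finset.sum_sub_distrib,
    failures, Set.indicator_apply, Set.mem_Iic, Finset.sum_boole, Finset.sum_const,
    Finset.card_range, nsmul_eq_mul]

lemma failures_le (τ : Fin I → ℝ) (T : Fin I → ℕ → Ω → ℝ) (K : Fin I → ℕ) (ω : Ω) (i : Fin I) :
    failures τ T K ω i ≤ K i :=
  (Finset.card_filter_le _ _).trans_eq (Finset.card_range _)

variable [MeasurableSpace Ω] {P : Measure Ω}

/-- The central limit theorem is applied to failure indicators, so equal failure probabilities
suffice and the full law of the lifetimes is not needed. -/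
lemma identDistrib_indicator {A A' : Set Ω} (hA : MeasurableSet A) (hA' : MeasurableSet A')
    [IsProbabilityMeasure P] (h : P A = P A') :
    IdentDistrib (A.indicator fun _ => (1 : ℝ)) (A'.indicator fun _ => (1 : ℝ)) P P where
  aemeasurable_fst := (measurable_const.indicator hA).aemeasurable
  aemeasurable_snd := (measurable_const.indicator hA').aemeasurable
  map_eq := by
    classical
    have hc : P Aᶜ = P A'ᶜ := by rw [prob_compl_eq_one_sub hA, prob_compl_eq_one_sub hA', h]
    ext s hs
    rw [Measure.map_apply (measurable_const.indicator hA) hs,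
      Measure.map_apply (measurable_const.indicator hA') hs,
      Set.indicator_const_preimage_eq_union, Set.indicator_const_preimage_eq_union]
    split_ifs <;> simp [h, hc]

lemma measurable_standardizedFailure (τ : ℝ) (x : Fin (J + 1) → ℝ) (θ₀ : Param J) :
    Measurable (standardizedFailure τ x θ₀) :=
  ((measurable_const.indicator measurableSet_Iic).sub_const _).div_const _

lemma tendstoInDistribution_sum_standardizedFailure [IsProbabilityMeasure P] {τ : ℝ} (hτ : 0 < τ)
    (x : Fin (J + 1) → ℝ) (θ₀ : Param J) {T : ℕ → Ω → ℝ}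
    (hlaw : ∀ k, IsLogLogistic P (T k) (scale x θ₀) (shape x θ₀)) (hind : iIndepFun T P) :
    TendstoInDistribution
      (fun (n : ℕ) ω => (√n)⁻¹ * ∑ k ∈ Finset.range n, standardizedFailure τ x θ₀ (T k ω))
      atTop (fun y : ℝ => y) (fun _ => P) (gaussianReal 0 1) := by
  have hA : ∀ k, MeasurableSet {ω | T k ω ≤ τ} := fun k => (hlaw k).1 measurableSet_Iic
  have hPA : ∀ k, P.real {ω | T k ω ≤ τ} = failProb τ x θ₀ := fun k => (hlaw k).2 τ hτ
  have hs := stdDev_pos hτ x θ₀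
  have hs2 := stdDev_sq hτ x θ₀
  rw [relProb_eq τ x hτ] at hs2
  have hint : Integrable ({ω | T 0 ω ≤ τ}.indicator fun _ => (1 : ℝ)) P :=
    (integrable_const 1).indicator (hA 0)
  have hval : ∫ ω, {ω | T 0 ω ≤ τ}.indicator (fun _ => (1 : ℝ)) ω ∂P = failProb τ x θ₀ := by
    rw [integral_indicator_const _ (hA 0), hPA, smul_eq_mul, mul_one]
  refine tendstoInDistribution_inv_sqrt_mul_sum
    (X := fun k ω => standardizedFailure τ x θ₀ (T k ω)) ⟨aemeasurable_id', Measure.map_id'⟩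
    ?_ ?_ (hind.comp _ fun _ => measurable_standardizedFailure τ x θ₀) fun k => ?_
  · change ∫ ω, ({ω | T 0 ω ≤ τ}.indicator (fun _ => (1 : ℝ)) ω - failProb τ x θ₀) /
      stdDev τ x θ₀ ∂P = 0
    rw [integral_div, integral_sub hint (integrable_const _), hval]
    simp
  -- An indicator equals its own square, so the squared variable is affine in the indicator.
  · have hsq : ∀ ω, (standardizedFailure τ x θ₀ (T 0 ω)) ^ 2 =
        ({ω | T 0 ω ≤ τ}.indicator (fun _ => (1 : ℝ)) ω * (1 - 2 * failProb τ x θ₀) +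
          failProb τ x θ₀ ^ 2) / stdDev τ x θ₀ ^ 2 := fun ω => by
      by_cases h : T 0 ω ≤ τ
      · rw [standardizedFailure, Set.indicator_of_mem (show T 0 ω ∈ Set.Iic τ from h),
          Set.indicator_of_mem (show ω ∈ {ω | T 0 ω ≤ τ} from h)]
        ring
      · rw [standardizedFailure, Set.indicator_of_notMem (show T 0 ω ∉ Set.Iic τ from h),
          Set.indicator_of_notMem (show ω ∉ {ω | T 0 ω ≤ τ} from h)]
        ring
    change ∫ ω, (standardizedFailure τ x θ₀ (T 0 ω)) ^ 2 ∂P = 1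
    simp only [hsq]
    rw [integral_div, integral_add (hint.mul_const _) (integrable_const _), integral_mul_const,
      hval, integral_const, probReal_univ, one_smul, div_eq_one_iff_eq (pow_ne_zero 2 hs.ne'), hs2]
    ring
  · exact (identDistrib_indicator (hA k) (hA 0) ((measureReal_eq_measureReal_iff).1
      ((hPA k).trans (hPA 0).symm))).comp
      (u := fun y => (y - failProb τ x θ₀) / stdDev τ x θ₀) (by fun_prop)

lemma tendsto_atTop_of_proportion {K : ℕ → Fin I → ℕ}
    (hK : Tendsto (fun N => total (K N)) atTop atTop) {w : Fin I → ℝ} (hw : ∀ i, 0 < w i)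
    (hKw : ∀ i, Tendsto (fun N => proportion (K N) i) atTop (𝓝 (w i))) (i : Fin I) :
    Tendsto (fun N => K N i) atTop atTop := by
  rw [← tendsto_natCast_atTop_iff (R := ℝ)]
  refine (hK.atTop_mul_pos (hw i) (hKw i)).congr' ?_
  filter_upwards [hK.eventually_gt_atTop 0] with N hN
  rw [proportion, mul_div_cancel₀ _ hN.ne']

lemma tendstoInDistribution_standardizedCount [IsProbabilityMeasure P] {τ : Fin I → ℝ}
    (hτ : ∀ i, 0 < τ i) (x : Fin I → Fin (J + 1) → ℝ) (θ₀ : Param J) {T : Fin I → ℕ → Ω → ℝ}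
    (hlaw : ∀ i k, IsLogLogistic P (T i k) (scale (x i) θ₀) (shape (x i) θ₀))
    (hindep : iIndepFun (fun (p : Fin I × ℕ) => T p.1 p.2) P)
    {K : ℕ → Fin I → ℕ} (hK : ∀ i, Tendsto (fun N => K N i) atTop atTop) :
    TendstoInDistribution (fun N ω => standardizedCount τ x θ₀ (K N) (failures τ T (K N) ω)) atTop
      (fun z : Fin I → ℝ => z) (fun _ => P) (Measure.pi fun _ => gaussianReal 0 1) := by
  have hmeas : ∀ i k, Measurable (T i k) := fun i k => (hlaw i k).1
  rw [show (fun N ω => standardizedCount τ x θ₀ (K N) (failures τ T (K N) ω)) = _ from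
    funext fun N => funext fun ω => funext fun i => standardizedCount_failures τ x θ₀ T (K N) ω i]
  refine tendstoInDistribution_pi (X := fun N i ω => (√(K N i))⁻¹ *
    ∑ k ∈ Finset.range (K N i), standardizedFailure (τ i) (x i) θ₀ (T i k ω)) (fun i => ?_)
    fun N => ?_
  · have h := tendstoInDistribution_sum_standardizedFailure (hτ i) (x i) θ₀ (hlaw i)
      (hindep.precomp (g := fun k => (i, k)) fun _ _ hk => (Prod.ext_iff.1 hk).2)
    exact ⟨fun N => h.forall_aemeasurable (K N i), h.aemeasurable_limit, h.tendsto.comp (hK i)⟩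
  · exact (iIndepFun_rows hmeas hindep).comp
      (fun i (y : ℕ → ℝ) => (√(K N i))⁻¹ *
        ∑ k ∈ Finset.range (K N i), standardizedFailure (τ i) (x i) θ₀ (y k))
      fun i => (Finset.measurable_fun_sum _ fun k _ =>
        (measurable_standardizedFailure _ _ _).comp (measurable_pi_apply k)).const_mul _

lemma measurable_failures {τ : Fin I → ℝ} {T : Fin I → ℕ → Ω → ℝ}
    (hT : ∀ i k, Measurable (T i k)) (K : Fin I → ℕ) : Measurable (failures τ T K) := by
  refine measurable_pi_lambda _ fun i => ?_
  simp only [failures, Finset.card_filter]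
  exact Finset.measurable_fun_sum _ fun k _ =>
    Measurable.ite ((hT i k) measurableSet_Iic) measurable_const measurable_const

end Counts

end OneShot

theorem mainTheorem9 {I J r : ℕ} (hr : 0 < r)
    -- the design: inspection times and stress vectors
    (τ : Fin I → ℝ) (hτ : ∀ i, 0 < τ i) (x : Fin I → Fin (J + 1) → ℝ)
    -- tuning parameter, parameter space, and estimator
    (γ : ℝ) (hγ : 0 ≤ γ) (Θ : Set (Param J))
    (est : (Fin I → ℕ) → (Fin I → ℕ) → Param J) (hest : IsWMDPDE γ τ x Θ est)
    -- numbers of devices in a sequence of experiments, with asymptotic proportions `w i > 0`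
    (K : ℕ → Fin I → ℕ) (hK : Tendsto (fun N => total (K N)) atTop atTop)
    (w : Fin I → ℝ) (hw : ∀ i, 0 < w i)
    (hKw : ∀ i, Tendsto (fun N => proportion (K N) i) atTop (𝓝 (w i)))
    -- the true parameter: interior, identifiable, with nonsingular `J_γ`
    (θ₀ : Param J) (hθ₀ : θ₀ ∈ interior Θ)
    (hident : ∀ ε > 0, ∃ δ > 0, ∀ θ ∈ Θ, ε ≤ dist θ θ₀ →
      ∃ i, δ ≤ |failProb (τ i) (x i) θ - failProb (τ i) (x i) θ₀|)
    (hJ : IsUnit (matJ γ τ x w θ₀).det)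
    -- the restrictions `m(θ) = 0`
    (m : Param J → Fin r → ℝ)
    (hm : ∀ᶠ θ in 𝓝 θ₀, DifferentiableAt ℝ m θ) (hM : ContinuousAt (gradMatrix m) θ₀)
    (hrank : (gradMatrix m θ₀).rank = r)
    -- independent log-logistic lifetimes
    {Ω : Type*} [MeasurableSpace Ω] (P : Measure Ω) [IsProbabilityMeasure P]
    (T : Fin I → ℕ → Ω → ℝ)
    (hlaw : ∀ i k, IsLogLogistic P (T i k) (scale (x i) θ₀) (shape (x i) θ₀))
    (hindep : iIndepFun (fun (p : Fin I × ℕ) => T p.1 p.2) P) :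
    -- under the null hypothesis: chi-square limit, and asymptotic level `α`
    (m θ₀ = 0 →
      TendstoInDistribution
        (fun N ω => waldStat γ τ x m (K N) (est (K N) (failures τ T (K N) ω)))
        atTop (fun y : ℝ => y) (fun _ => P) (chiSquare r) ∧
      ∀ α : ℝ, 0 < α → α < 1 →
        Tendsto (fun N => P.real {ω | chiSquareQuantile r α <
          waldStat γ τ x m (K N) (est (K N) (failures τ T (K N) ω))}) atTop (𝓝 α)) ∧
    -- under a fixed alternative: consistency of the test
    (m θ₀ ≠ 0 → ∀ α : ℝ, 0 < α → α < 1 →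
      Tendsto (fun N => P.real {ω | chiSquareQuantile r α <
        waldStat γ τ x m (K N) (est (K N) (failures τ T (K N) ω))}) atTop (𝓝 1)) := by
  have hKt := tendsto_atTop_of_proportion hK hw hKw
  have hZ := tendstoInDistribution_standardizedCount hτ x θ₀ hlaw hindep hKt
  -- No regularity of `est` is required: the counts take values in a countable space, on which every
  -- function is measurable.
  have hmeas : ∀ N, Measurable fun ω =>
      waldStat γ τ x m (K N) (est (K N) (failures τ T (K N) ω)) := fun N =>
    (measurable_of_countable fun n => waldStat γ τ x m (K N) (est (K N) n)).comp
      (measurable_failures (fun i k => (hlaw i k).1) (K N))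
  -- An eventual statement along `L R` holds for all large `N` and all sample points with `‖z‖ ≤ R`
  -- at once. This turns the deterministic limits into uniform ones.
  let L : ℝ → Filter (ℕ × Ω) := fun R => comap Prod.fst atTop ⊓
    𝓟 {a | ‖standardizedCount τ x θ₀ (K a.1) (failures τ T (K a.1) a.2)‖ ≤ R}
  have hL : ∀ R, Tendsto Prod.fst (L R) atTop := fun R => tendsto_comap.mono_left inf_le_left
  have hLR : ∀ R, ∀ᶠ a in L R,
      ‖standardizedCount τ x θ₀ (K a.1) (failures τ T (K a.1) a.2)‖ ≤ R := fun R =>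
    mem_inf_of_right (mem_principal_self _)
  have hLev : ∀ (R : ℝ) (p : ℕ × Ω → Prop), (∀ᶠ a in L R, p a) → ∀ᶠ N in atTop, ∀ ω,
      ‖standardizedCount τ x θ₀ (K N) (failures τ T (K N) ω)‖ ≤ R → p (N, ω) := fun R p hp => by
    rw [eventually_inf_principal, eventually_comap] at hp
    exact hp.mono fun N h ω => h (N, ω) rfl
  have hKL : ∀ R, Tendsto (fun a : ℕ × Ω => total (K a.1)) (L R) atTop := fun R => hK.comp (hL R)
  have hKwL : ∀ R, Tendsto (fun a : ℕ × Ω => proportion (K a.1)) (L R) (𝓝 w) := fun R =>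
    (tendsto_pi_nhds.2 hKw).comp (hL R)
  have hnL : ∀ R, ∀ᶠ a in L R, ∀ i, failures τ T (K a.1) a.2 i ≤ K a.1 i := fun R =>
    Eventually.of_forall fun a => failures_le τ T (K a.1) a.2
  have hmd := hm.self_of_nhds
  refine ⟨fun hm₀ => ?_, fun hm₀ α hα₀ hα₁ => tendsto_one_of_bounded hZ fun R =>
    hLev R (fun a => chiSquareQuantile r α <
      waldStat γ τ x m (K a.1) (est (K a.1) (failures τ T (K a.1) a.2)))
    ((waldStat_tendsto_atTop hγ hτ hest hθ₀ hident hJ hw hmd hM hrank hm₀ (hKL R) (hKwL R) (hnL R)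
      (hLR R)).eventually_gt_atTop _)⟩
  have hlimit := tendstoInDistribution_of_bounded_approx hZ
    (continuous_limitForm (limitMatrix γ τ x w m θ₀)) (fun N => (hmeas N).aemeasurable)
    fun R ε hε => hLev R (fun a => |waldStat γ τ x m (K a.1)
      (est (K a.1) (failures τ T (K a.1) a.2)) - limitForm (limitMatrix γ τ x w m θ₀)
        (standardizedCount τ x θ₀ (K a.1) (failures τ T (K a.1) a.2))| < ε)
      ((waldStat_sub_limitForm hγ hτ hest hθ₀ hident hJ hw hmd hM hrank hm₀ (hKL R) (hKwL R)
        (hnL R) (hLR R)).abs.eventually_lt_const (by simpa using hε))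
  have hdist : TendstoInDistribution
      (fun N ω => waldStat γ τ x m (K N) (est (K N) (failures τ T (K N) ω)))
      atTop (fun y : ℝ => y) (fun _ => P) (chiSquare r) := by
    refine ⟨hlimit.forall_aemeasurable, aemeasurable_id', hlimit.tendsto.trans_eq
      (congrArg 𝓝 (Subtype.ext ?_))⟩
    exact (map_limitForm (posDef_limitMatrix γ τ x w hτ hw m hJ hrank)).trans Measure.map_id'.symm
  refine ⟨hdist, fun α hα₀ hα₁ => ?_⟩
  have := nullSingletonClass_chiSquare hr
  -- The rejection region has a single boundary point, the quantile, which is null for the limit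
  -- law.
  have hport := ProbabilityMeasure.tendsto_measure_of_null_frontier_of_tendsto' hdist.tendsto
    (E := Set.Ioi (chiSquareQuantile r α)) (by
      rw [frontier_Ioi]
      simp [Measure.map_id'])
  simp only [ProbabilityMeasure.coe_mk, Measure.map_id'] at hport
  have hreal := (ENNReal.tendsto_toReal (measure_ne_top _ _)).comp hport
  change Tendsto _ atTop (𝓝 ((chiSquare r).real (Set.Ioi (chiSquareQuantile r α)))) at hreal
  rw [chiSquare_Ioi_quantile hr hα₀ hα₁] at hreal
  refine hreal.congr fun N => ?_
  rw [Function.comp, Measure.map_apply (hmeas N) measurableSet_Ioi]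
  rfl
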